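/- Let $M$ be a connected (Hausdorff, second countable, finite-dimensional) smooth manifold with a smooth Lorentzian metric $g$. Let $\mathfrak k$ be the Lie algebra of smooth Killing vector fields of $(M,g)$, with radical $\mathfrak r$ (so $\mathfrak k=\mathfrak s\ltimes\mathfrak r$ is its Levi decomposition), and let $\mathfrak g$ be a Lie algebra of smooth vector fields on $M$ that contains $\mathfrak k$ as an ideal. Put $\mathfrak r_0=\mathfrak r$, $\mathfrak r_i=[\mathfrak r_{i-1},\mathfrak r_{i-1}]$, let $\mathfrak z(\mathfrak r_i)$ be the center of $\mathfrak r_i$, and let $$\mathfrak a(\mathfrak r)=\sum_i\mathfrak z(\mathfrak r_i)=\langle K_1,\dots,K_r\rangle,$$ where $K_1,\dots,K_r$ is a basis. A Killing horizon is an (injectively immersed) hypersurface $\mathcal H\subset M$ that is null, i.e. $g|_{T_a\mathcal H}$ is degenerate for all $a\in\mathcal H$, and for which there is $K\in\mathfrak k$ with $K_a\in T_a\mathcal H\setminus\{0\}$ and $g(K_a,K_a)=0$ for all $a\in\mathcal H$; it is $\mathfrak k$-invariant if $X_a\in T_a\mathcal H$ for all $X\in\mathfrak k$ and $a\in\mathcal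 H$. Let $\pi\colon J^0\pi=S^2_{\mathrm{Lor}}T^*M\to M$ be the bundle of symmetric bilinear forms of Lorentzian signature, $h$ the horizontal symmetric 2-form on $J^0\pi$ given by $h_\theta(v,w)=\theta(d\pi\,v,d\pi\,w)$, and, for a vector field $X$ on $M$, let $X^{(0)}$ be its prolongation, the unique vector field on $J^0\pi$ that projects to $X$ and satisfies $L_{X^{(0)}}h=0$. For a symmetric bilinear form $B$ write $\|v_1\wedge\dots\wedge v_r\|_B^2=\det(B(v_i,v_j))$ for the induced form on $r$-vectors, and set $$R_g=\|K_1\wedge\dots\wedge K_r\|_g^2\in C^\infty(M),\qquad R^{\mathfrak a(\mathfrak r)}=\|K_1^{(0)}\wedge\dots\wedge K_r^{(0)}\|_h^2\in C^\infty(J^0\pi).$$ Then: 1. $\mathfrak a(\mathfrak r)$ is abelian, and it is an ideal of $\mathfrak g$. 2. If $\mathcal H$ is a $\mathfrak k$-invariant Killing horizon, then $R_g$ vanishes on $\mathcal H$. 3. $R_g$ is the restriction to $g$ of a relative invariant of $\mathfrak g$: one has $R_g=R^{\mathfrak a(\mathfrak r)}\circ g$, and there is a linear map $\lambda\colon\mathfrak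 g\to\mathbb R$ such that, for all $X\in\mathfrak g$, $L_X(K_1\wedge\dots\wedge K_r)=\lambda(X)\,K_1\wedge\dots\wedge K_r$ on $M$ and $X^{(0)}(R^{\mathfrak a(\mathfrak r)})=2\lambda(X)\,R^{\mathfrak a(\mathfrak r)}$ on $J^0\pi$. -/

import Mathlib

noncomputable section

namespace KillingHorizons

open Bundle Set VectorField
open scoped Manifold ContDiff Topology

variable (E : Type*) [NormedAddCommGroup E] [NormedSpace ℝ E] [FiniteDimensional ℝ E]
  (M : Type*) [TopologicalSpace M] [ChartedSpace E M] [IsManifold 𝓘(ℝ, E) ∞ M]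

/-- Smooth vector fields on `M`. -/
abbrev VField : Type _ :=
  ContMDiffSection 𝓘(ℝ, E) E ∞ (fun x : M => TangentSpace 𝓘(ℝ, E) x)

variable {E M}

instance : IsManifold 𝓘(ℝ, E) (minSmoothness ℝ 3) M := by
  simp only [minSmoothness_of_isRCLikeNormedField]
  exact IsManifold.of_le (n := ∞) (ENat.LEInfty.out)

theorem VField.mdiffAt (X : VField E M) (a : M) :
    MDiffAt (T% (fun x => X x)) a :=
  (X.contMDiff a).mdifferentiableAt (by simp)

theorem VField.contMDiff_mlieBracket (X Y : VField E M) :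
    CMDiff ∞ (T% (mlieBracket 𝓘(ℝ, E) (fun x => X x) (fun x => Y x))) := by
  have : IsManifold 𝓘(ℝ, E) (((⊤ : ℕ∞) : ℕ∞ω) + 1) M := by simpa using ‹IsManifold 𝓘(ℝ, E) ∞ M›
  exact ContDiff.mlieBracket_vectorField (m := ⊤) (n := ⊤) X.contMDiff Y.contMDiff (by simp)

instance : Bracket (VField E M) (VField E M) where
  bracket X Y := ⟨mlieBracket 𝓘(ℝ, E) (fun x => X x) (fun x => Y x), X.contMDiff_mlieBracket Y⟩

theorem VField.bracket_apply (X Y : VField E M) (a : M) :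
    ⁅X, Y⁆ a = mlieBracket 𝓘(ℝ, E) (fun x => X x) (fun x => Y x) a := rfl

instance : LieRing (VField E M) where
  add_lie X Y Z := by
    ext a
    exact mlieBracket_add_left (X.mdiffAt a) (Y.mdiffAt a)
  lie_add X Y Z := by
    ext a
    exact mlieBracket_add_right (Y.mdiffAt a) (Z.mdiffAt a)
  lie_self X := by
    ext a
    exact congrFun mlieBracket_self a
  leibniz_lie X Y Z := by
    ext a
    have h : ∀ X : VField E M, CMDiffAt (minSmoothness ℝ 2) (T% (fun x => X x)) a := fun X => by
      simp only [minSmoothness_of_isRCLikeNormedField]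
      exact (X.contMDiff a).of_le (ENat.LEInfty.out)
    exact leibniz_identity_mlieBracket_apply (h X) (h Y) (h Z)

instance : LieAlgebra ℝ (VField E M) where
  lie_smul c X Y := by
    ext a
    exact mlieBracket_const_smul_right (Y.mdiffAt a)

/-- The derivative `X f` of a function along a vector field is smooth. -/
theorem VField.contMDiff_deriv (X : VField E M) {f : M → ℝ} (hf : CMDiff ∞ f) :
    CMDiff ∞ (fun a => mvfderiv 𝓘(ℝ, E) f a (X a)) := by
  have h := (hf.contMDiff_tangentMap (m := ∞) (by simp)).comp X.contMDiff
  exact (contMDiff_snd_tangentBundle_modelSpace ℝ 𝓘(ℝ, ℝ)).comp h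

/-- Multiplication of a vector field by a function. -/
def VField.fsmul {f : M → ℝ} (hf : CMDiff ∞ f) (X : VField E M) : VField E M :=
  ⟨f • (fun x => X x), hf.smul_section X.contMDiff⟩

theorem VField.lie_fsmul (X Y : VField E M) {f : M → ℝ} (hf : CMDiff ∞ f) :
    ⁅X, VField.fsmul hf Y⁆ =
      VField.fsmul (X.contMDiff_deriv hf) Y + VField.fsmul hf ⁅X, Y⁆ := by
  ext a
  exact mlieBracket_smul_right ((hf a).mdifferentiableAt (by simp)) (Y.mdiffAt a)

/-- The bracket acts on functions as the commutator. -/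
theorem VField.deriv_bracket (X Y : VField E M) {f : M → ℝ} (hf : CMDiff ∞ f) (a : M) :
    mvfderiv 𝓘(ℝ, E) f a (⁅X, Y⁆ a) =
      mvfderiv 𝓘(ℝ, E) (fun b => mvfderiv 𝓘(ℝ, E) f b (Y b)) a (X a) -
        mvfderiv 𝓘(ℝ, E) (fun b => mvfderiv 𝓘(ℝ, E) f b (X b)) a (Y a) := by
  have key : ∀ Z : VField E M,
      (mvfderiv 𝓘(ℝ, E) f a (⁅X, Y⁆ a) -
      (mvfderiv 𝓘(ℝ, E) (fun b => mvfderiv 𝓘(ℝ, E) f b (Y b)) a (X a) -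
        mvfderiv 𝓘(ℝ, E) (fun b => mvfderiv 𝓘(ℝ, E) f b (X b)) a (Y a))) • Z a = 0 := by
    intro Z
    have h := congrArg (fun W : VField E M => W a) (leibniz_lie X Y (VField.fsmul hf Z))
    have h0 := congrArg (fun W : VField E M => f a • W a) (leibniz_lie X Y Z)
    simp only [VField.lie_fsmul, lie_add] at h
    change (((_ : ℝ) • Z a + (_ : ℝ) • ⁅X, Z⁆ a) + ((_ : ℝ) • ⁅Y, Z⁆ a + f a • ⁅X, ⁅Y, Z⁆⁆ a) : TangentSpace 𝓘(ℝ, E) a)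
      = ((_ : ℝ) • Z a + f a • ⁅⁅X, Y⁆, Z⁆ a) +
        (((_ : ℝ) • Z a + (_ : ℝ) • ⁅Y, Z⁆ a) + ((_ : ℝ) • ⁅X, Z⁆ a + f a • ⁅Y, ⁅X, Z⁆⁆ a)) at h
    change f a • ⁅X, ⁅Y, Z⁆⁆ a = f a • (⁅⁅X, Y⁆, Z⁆ a + ⁅Y, ⁅X, Z⁆⁆ a) at h0
    rw [h0, smul_add] at h
    rw [← neg_eq_zero, ← sub_eq_zero.2 h]
    module
  by_cases hX : X a = 0
  · by_cases hY : Y a = 0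
    · by_cases hXY : ⁅X, Y⁆ a = 0
      · simp [hX, hY, hXY]
      · exact sub_eq_zero.1 ((smul_eq_zero.1 (key _)).resolve_right hXY)
    · exact sub_eq_zero.1 ((smul_eq_zero.1 (key _)).resolve_right hY)
  · exact sub_eq_zero.1 ((smul_eq_zero.1 (key _)).resolve_right hX)

variable (E M) in
/-- The total space of the bundle `T*M ⊗ T*M` of bilinear forms on the tangent spaces of `M`. -/
abbrev BilinBundle : Type _ :=
  TotalSpace (E →L[ℝ] E →L[ℝ] ℝ)
    (fun x : M => TangentSpace 𝓘(ℝ, E) x →L[ℝ] TangentSpace 𝓘(ℝ, E) x →L[ℝ] ℝ)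

/-- The model with corners of the manifold `T*M ⊗ T*M`. -/
abbrev bilinModel (E : Type*) [NormedAddCommGroup E] [NormedSpace ℝ E] :
    ModelWithCorners ℝ (E × (E →L[ℝ] E →L[ℝ] ℝ)) (ModelProd E (E →L[ℝ] E →L[ℝ] ℝ)) :=
  (𝓘(ℝ, E)).prod 𝓘(ℝ, E →L[ℝ] E →L[ℝ] ℝ)

/-- A symmetric bilinear form of Lorentzian signature `(-, +, …, +)`: there is a timelike vector
whose orthogonal complement is positive definite. -/
def IsLorentzForm {V : Type*} [AddCommGroup V] [Module ℝ V] [TopologicalSpace V]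
    (B : V →L[ℝ] V →L[ℝ] ℝ) : Prop :=
  (∀ v w, B v w = B w v) ∧ ∃ t, B t t < 0 ∧ ∀ v, B t v = 0 → v ≠ 0 → 0 < B v v

variable (E M) in
/-- The total space `J⁰π = S²_Lor T*M`, as a subset of `T*M ⊗ T*M`. -/
def lorentzBundle : Set (BilinBundle E M) := {θ | IsLorentzForm θ.2}

variable (E M) in
/-- A smooth Lorentzian metric on `M`, i.e. a smooth section of `S²_Lor T*M → M`. -/
structure LorentzMetric where
  toFun (a : M) : TangentSpace 𝓘(ℝ, E) a →L[ℝ] TangentSpace 𝓘(ℝ, E) a →L[ℝ] ℝ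
  isLorentz (a : M) : IsLorentzForm (toFun a)
  contMDiff : ContMDiff 𝓘(ℝ, E) (bilinModel E) ∞
    (fun a => (TotalSpace.mk' (E →L[ℝ] E →L[ℝ] ℝ) a (toFun a) : BilinBundle E M))

/-- The metric as a section of `J⁰π → M`. -/
def LorentzMetric.toSection (g : LorentzMetric E M) (a : M) : BilinBundle E M :=
  ⟨a, g.toFun a⟩

/-- `X` is a Killing vector field of `g`: `L_X g = 0`. -/
def IsKilling (g : LorentzMetric E M) (X : VField E M) : Prop :=
  ∀ (Y Z : VField E M) (a : M),
    mvfderiv 𝓘(ℝ, E) (fun b => g.toFun b (Y b) (Z b)) a (X a) =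
      g.toFun a (⁅X, Y⁆ a) (Z a) + g.toFun a (Y a) (⁅X, Z⁆ a)

theorem LorentzMetric.contMDiff_apply (g : LorentzMetric E M) (Y Z : VField E M) :
    CMDiff ∞ (fun b => g.toFun b (Y b) (Z b)) := by
  have h := ContMDiff.clm_bundle_apply₂ (IB := 𝓘(ℝ, E)) (F₃ := ℝ) (E₃ := fun _ : M => ℝ)
     (b := fun x : M => x) (n := ∞) g.contMDiff Y.contMDiff Z.contMDiff
  intro a
  exact ((contMDiffAt_totalSpace).1 (h a)).2

/-- The Lie algebra of Killing vector fields of `g`. -/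
def killingAlgebra (g : LorentzMetric E M) : LieSubalgebra ℝ (VField E M) where
  carrier := {X | IsKilling g X}
  zero_mem' := by
    intro Y Z a
    simp
  add_mem' := by
    intro X X' hX hX' Y Z a
    have := hX Y Z a
    have := hX' Y Z a
    simp only [add_lie, ContMDiffSection.coe_add, Pi.add_apply, map_add,
      add_apply]
    linarith
  smul_mem' := by
    intro c X hX Y Z a
    have := hX Y Z a
    simp only [smul_lie, ContMDiffSection.coe_smul, Pi.smul_apply, map_smul,
      smul_apply, smul_eq_mul]
    rw [this]
    ring
  lie_mem' := by
    intro X X' hX hX' Y Z a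
    have hd : ∀ (U V : VField E M) (b : M), MDiffAt (fun b => g.toFun b (U b) (V b)) b :=
      fun U V b => (g.contMDiff_apply U V b).mdifferentiableAt (by simp)
    rw [VField.deriv_bracket X X' (g.contMDiff_apply Y Z) a]
    rw [show (fun b => mvfderiv 𝓘(ℝ, E) (fun b => g.toFun b (Y b) (Z b)) b (X' b)) = _ from
        funext fun b => hX' Y Z b,
      show (fun b => mvfderiv 𝓘(ℝ, E) (fun b => g.toFun b (Y b) (Z b)) b (X b)) = _ from
        funext fun b => hX Y Z b,
      mvfderiv_fun_add (hd _ _ _) (hd _ _ _), mvfderiv_fun_add (hd _ _ _) (hd _ _ _)]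
    simp only [add_apply, hX _ _ a, hX' _ _ a, lie_lie,
      ContMDiffSection.coe_sub, Pi.sub_apply, map_sub, sub_apply]
    ring

section LieAlgebra

variable {L : Type*} [LieRing L] [LieAlgebra ℝ L]

/-- The center `{x ∈ I | [x, y] = 0 for all y ∈ I}` of an ideal `I`; it is an ideal of the ambient
Lie algebra. -/
def idealCenter (I : LieIdeal ℝ L) : LieIdeal ℝ L where
  carrier := {x | x ∈ I ∧ ∀ y ∈ I, ⁅x, y⁆ = 0}
  zero_mem' := ⟨I.zero_mem, fun y _ => zero_lie y⟩
  add_mem' := fun hx hy => ⟨I.add_mem hx.1 hy.1, fun z hz => by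
    rw [add_lie, hx.2 z hz, hy.2 z hz, add_zero]⟩
  smul_mem' := fun c x hx => ⟨I.smul_mem c hx.1, fun z hz => by
    rw [smul_lie, hx.2 z hz, smul_zero]⟩
  lie_mem := fun {z x} hx => ⟨LieSubmodule.lie_mem I hx.1, fun y hy => by
    rw [lie_lie, hx.2 y hy, hx.2 _ (LieSubmodule.lie_mem I hy), lie_zero, sub_zero]⟩

variable (L) in
/-- The ideal `𝔞(𝔯) = 𝔷(𝔯₀) + 𝔷(𝔯₁) + …`, where `𝔯 = 𝔯₀ ⊇ 𝔯₁ ⊇ …` is the derived series of the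
radical `𝔯` of the Lie algebra `L`. -/
def radicalAbelianIdeal : LieIdeal ℝ L :=
  ⨆ i : ℕ, idealCenter (LieAlgebra.derivedSeriesOfIdeal ℝ L i (LieAlgebra.radical ℝ L))

end LieAlgebra

/-- The bilinear form induced by `B` on the `r`-th exterior power:
`B(v₁ ∧ … ∧ v_r, w₁ ∧ … ∧ w_r) = det (B(v_i, w_j))`. -/
def exteriorForm {V : Type*} [AddCommGroup V] [Module ℝ V] (B : V →ₗ[ℝ] V →ₗ[ℝ] ℝ) (r : ℕ) :
    ⋀[ℝ]^r V →ₗ[ℝ] ⋀[ℝ]^r V →ₗ[ℝ] ℝ :=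
  exteriorPower.pairingDual ℝ V r ∘ₗ exteriorPower.map r B

/-- `‖v₁ ∧ … ∧ v_r‖²_B`. -/
def wedgeNormSq {V : Type*} [AddCommGroup V] [Module ℝ V] (B : V →ₗ[ℝ] V →ₗ[ℝ] ℝ) {r : ℕ}
    (v : Fin r → V) : ℝ :=
  exteriorForm B r (exteriorPower.ιMulti ℝ r v) (exteriorPower.ιMulti ℝ r v)

/-- The horizontal symmetric 2-form `h` on `T*M ⊗ T*M`: `h_θ(v, w) = θ(dπ v, dπ w)`. -/
def horizontalForm (θ : BilinBundle E M) :
    TangentSpace (bilinModel E) θ →ₗ[ℝ] TangentSpace (bilinModel E) θ →ₗ[ℝ] ℝ :=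
  (ContinuousLinearMap.toLinearMap₁₂ θ.2).compl₁₂
    (mfderiv (bilinModel E) 𝓘(ℝ, E) (TotalSpace.proj : BilinBundle E M → M) θ).toLinearMap
    (mfderiv (bilinModel E) 𝓘(ℝ, E) (TotalSpace.proj : BilinBundle E M → M) θ).toLinearMap

/-- The components of the vector field `Y` at `b` in the coordinates of the preferred chart at `a`;
for `b = a` this is `Y a`. -/
def VField.coord (a : M) (Y : VField E M) (b : M) : E :=
  (trivializationAt E (fun x : M => TangentSpace 𝓘(ℝ, E) x) a ⟨b, Y b⟩).2

/-- The matrix `∂ⱼ Xⁱ` of partial derivatives at `a` of the components of `X` in the preferred chart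
at `a`. -/
def VField.coordDeriv (X : VField E M) (a : M) : E →L[ℝ] E :=
  mvfderiv 𝓘(ℝ, E) (VField.coord a X) a

/-- The prolongation `X⁽⁰⁾` of a vector field `X = Xⁱ ∂ᵢ` on `M` to the bundle of bilinear forms.
In the fibre coordinates `u` of the chart at the base point of `θ` it is
`X⁽⁰⁾ = Xⁱ ∂ᵢ - (u_{kj} ∂ᵢ Xᵏ + u_{ik} ∂ⱼ Xᵏ) ∂_{u_{ij}}`. By `proj_prolong` and `lie_prolong`
below it projects to `X` and satisfies `L_{X⁽⁰⁾} h = 0`, which determines it. -/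
def prolong (X : VField E M) (θ : BilinBundle E M) : TangentSpace (bilinModel E) θ :=
  let A : E →L[ℝ] E := X.coordDeriv θ.proj
  let B : E →L[ℝ] E →L[ℝ] ℝ := θ.2
  (X θ.proj, -(B.bilinearComp A (.id ℝ E) + B.bilinearComp (.id ℝ E) A))

section Bundle
variable {F : Type*} [NormedAddCommGroup F] [NormedSpace ℝ F] {V : M → Type*}
  [TopologicalSpace (TotalSpace F V)] [∀ x, TopologicalSpace (V x)] [FiberBundle F V]

theorem hasMFDerivAt_proj (θ : TotalSpace F V) :
   HasMFDerivAt ((𝓘(ℝ, E)).prod 𝓘(ℝ, F)) 𝓘(ℝ, E) (TotalSpace.proj : TotalSpace F V → M) θ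
     (ContinuousLinearMap.fst ℝ E F) := by
  refine ⟨(FiberBundle.continuous_proj _ _).continuousAt, ?_⟩
  have h : HasFDerivWithinAt (Prod.fst : E × F → E) (ContinuousLinearMap.fst ℝ E F) (range ((𝓘(ℝ, E)).prod 𝓘(ℝ, F))) (extChartAt ((𝓘(ℝ, E)).prod 𝓘(ℝ, F)) θ θ) := hasFDerivWithinAt_fst
  have hc : ∀ η ∈ (extChartAt ((𝓘(ℝ, E)).prod 𝓘(ℝ, F)) θ).source, (extChartAt ((𝓘(ℝ, E)).prod 𝓘(ℝ, F)) θ η).1 = extChartAt 𝓘(ℝ, E) θ.proj η.proj := by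
    intro η hη
    rw [FiberBundle.extChartAt] at hη ⊢
    rw [PartialEquiv.trans_source] at hη
    exact congrArg (extChartAt 𝓘(ℝ, E) θ.proj) (Trivialization.coe_fst _ hη.1)
  refine h.congr_of_eventuallyEq ?_ ?_
  · filter_upwards [extChartAt_target_mem_nhdsWithin (I := (𝓘(ℝ, E)).prod 𝓘(ℝ, F)) θ] with z hz
    have := (extChartAt ((𝓘(ℝ, E)).prod 𝓘(ℝ, F)) θ).right_inv hz
    have h2 := (extChartAt ((𝓘(ℝ, E)).prod 𝓘(ℝ, F)) θ).map_target hz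
    have h4 := congrArg Prod.fst this
    rw [hc _ h2] at h4
    rw [← h4, ]
    simp only [writtenInExtChartAt, Function.comp]
  · have := (extChartAt ((𝓘(ℝ, E)).prod 𝓘(ℝ, F)) θ).left_inv (mem_extChartAt_source θ)
    simp only [writtenInExtChartAt, Function.comp, this]
    exact (hc _ (mem_extChartAt_source θ)).symm

theorem hasMFDerivAt_snd (θ : TotalSpace F V) :
   HasMFDerivAt ((𝓘(ℝ, E)).prod 𝓘(ℝ, F)) 𝓘(ℝ, F)
     (fun η : TotalSpace F V => (trivializationAt F V θ.proj η).2) θ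
     (ContinuousLinearMap.snd ℝ E F) := by
  refine ⟨?_, ?_⟩
  · refine continuous_snd.continuousAt.comp ?_
    exact (trivializationAt F V θ.proj).continuousAt (FiberBundle.mem_trivializationAt_proj_source)
  have h : HasFDerivWithinAt (Prod.snd : E × F → F) (ContinuousLinearMap.snd ℝ E F) (range ((𝓘(ℝ, E)).prod 𝓘(ℝ, F))) (extChartAt ((𝓘(ℝ, E)).prod 𝓘(ℝ, F)) θ θ) := hasFDerivWithinAt_snd
  refine h.congr_of_eventuallyEq ?_ ?_
  · filter_upwards [extChartAt_target_mem_nhdsWithin (I := (𝓘(ℝ, E)).prod 𝓘(ℝ, F)) θ] with z hz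
    have := (extChartAt ((𝓘(ℝ, E)).prod 𝓘(ℝ, F)) θ).right_inv hz
    exact congrArg Prod.snd this
  · have := (extChartAt ((𝓘(ℝ, E)).prod 𝓘(ℝ, F)) θ).left_inv (mem_extChartAt_source θ)
    simp only [writtenInExtChartAt, Function.comp, this]
    rfl

end Bundle

/-- `X⁽⁰⁾` projects to `X`. -/
theorem proj_prolong (X : VField E M) (θ : BilinBundle E M) :
    mfderiv (bilinModel E) 𝓘(ℝ, E) (TotalSpace.proj : BilinBundle E M → M) θ (prolong X θ) =
      X θ.proj := by
  rw [(hasMFDerivAt_proj θ).mfderiv]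
  rfl

theorem coord_eq (Y : VField E M) (a b : M) (hb : b ∈ (chartAt E a).source) : VField.coord a Y b = mfderiv 𝓘(ℝ, E) 𝓘(ℝ, E) (extChartAt 𝓘(ℝ, E) a) b (Y b) := by
  rw [← TangentBundle.continuousLinearMapAt_trivializationAt hb]
  erw [Trivialization.continuousLinearMapAt_apply, Trivialization.coe_linearMapAt_of_mem _ hb]
  rfl

theorem coord_self (Y : VField E M) (a : M) : VField.coord a Y a = Y a := by
  have : VField.coord a Y a = (tangentBundleCore 𝓘(ℝ, E) M).coordChange (achart E a) (achart E a) a (Y a) := rfl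
  rw [this]
  exact (tangentBundleCore 𝓘(ℝ, E) M).coordChange_self _ _ (mem_chart_source E a) _

theorem coord_mdiff (Y : VField E M) (a : M) : MDiffAt (VField.coord a Y) a :=
  ((contMDiffAt_totalSpace).1 (Y.contMDiff a)).2.mdifferentiableAt (by simp)

theorem bracket_coord (X Y : VField E M) (a : M) :
  ⁅X, Y⁆ a = mvfderiv 𝓘(ℝ, E) (VField.coord a Y) a (X a) - mvfderiv 𝓘(ℝ, E) (VField.coord a X) a (Y a) := by
  have key : ∀ Z : VField E M, mpullbackWithin 𝓘(ℝ, E) 𝓘(ℝ, E) (extChartAt 𝓘(ℝ, E) a).symm (fun x => Z x) (range 𝓘(ℝ, E)) =ᶠ[𝓝 (extChartAt 𝓘(ℝ, E) a a)] (VField.coord a Z ∘ (extChartAt 𝓘(ℝ, E) a).symm) := by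
    intro Z
    filter_upwards [extChartAt_target_mem_nhds (I := 𝓘(ℝ, E)) a] with y hy
    rw [mpullbackWithin_apply, Function.comp, coord_eq]
    · congr 1
      exact ContinuousLinearMap.inverse_eq (mfderivWithin_extChartAt_symm_comp_mfderiv_extChartAt hy) (mfderiv_extChartAt_comp_mfderivWithin_extChartAt_symm hy)
    · simpa using (extChartAt 𝓘(ℝ, E) a).map_target hy
  have hfd : ∀ Z : VField E M, mvfderiv 𝓘(ℝ, E) (VField.coord a Z) a = fderiv ℝ (VField.coord a Z ∘ (extChartAt 𝓘(ℝ, E) a).symm) (extChartAt 𝓘(ℝ, E) a a) := by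
    intro Z
    have := (coord_mdiff Z a).mvfderiv
    rw [this]
    simp only [modelWithCornersSelf_coe, range_id, fderivWithin_univ]
    rfl
  have hid : mfderiv 𝓘(ℝ, E) 𝓘(ℝ, E) (extChartAt 𝓘(ℝ, E) a) a = ContinuousLinearMap.id ℝ E := by
    ext v
    rw [← TangentBundle.continuousLinearMapAt_trivializationAt (mem_chart_source E a)]
    rw [TangentBundle.continuousLinearMapAt_trivializationAt_eq_core (mem_chart_source E a)]
    exact (tangentBundleCore 𝓘(ℝ, E) M).coordChange_self _ _ (mem_chart_source E a) _
  rw [VField.bracket_apply, ← mlieBracketWithin_univ, mlieBracketWithin_apply]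
  rw [hfd, hfd]
  let W : VField E M → E → E := fun Z =>
    mpullbackWithin 𝓘(ℝ, E) 𝓘(ℝ, E) (extChartAt 𝓘(ℝ, E) a).symm (fun x => Z x) (range 𝓘(ℝ, E))
  let P : E →L[ℝ] E := mfderiv 𝓘(ℝ, E) 𝓘(ℝ, E) (extChartAt 𝓘(ℝ, E) a) a
  have hP : P = ContinuousLinearMap.id ℝ E := hid
  have hset : ((extChartAt 𝓘(ℝ, E) a).symm ⁻¹' univ ∩ range 𝓘(ℝ, E)) = univ := by simp
  have e : lieBracketWithin ℝ (W X) (W Y) ((extChartAt 𝓘(ℝ, E) a).symm ⁻¹' univ ∩ range 𝓘(ℝ, E))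
      (extChartAt 𝓘(ℝ, E) a a) =
      lieBracket ℝ (VField.coord a X ∘ (extChartAt 𝓘(ℝ, E) a).symm)
        (VField.coord a Y ∘ (extChartAt 𝓘(ℝ, E) a).symm) (extChartAt 𝓘(ℝ, E) a a) := by
    rw [hset, lieBracketWithin_univ]
    exact Filter.EventuallyEq.lieBracket_vectorField_eq (𝕜 := ℝ) (key X) (key Y)
  change P.inverse (lieBracketWithin ℝ (W X) (W Y)
    ((extChartAt 𝓘(ℝ, E) a).symm ⁻¹' univ ∩ range 𝓘(ℝ, E)) (extChartAt 𝓘(ℝ, E) a a)) = _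
  rw [e, hP, ContinuousLinearMap.inverse_id]
  simp only [lieBracket, Function.comp, extChartAt_to_inv, coord_self]
  rfl

theorem eval_eq (Y Z : VField E M) (θ η : BilinBundle E M) (h : η.proj ∈ (chartAt E θ.proj).source) :
   η.2 (Y η.proj) (Z η.proj) =
   ((trivializationAt (E →L[ℝ] E →L[ℝ] ℝ) (fun x : M => TangentSpace 𝓘(ℝ, E) x →L[ℝ] TangentSpace 𝓘(ℝ, E) x →L[ℝ] ℝ) θ.proj) η).2 (VField.coord θ.proj Y η.proj) (VField.coord θ.proj Z η.proj) := by
  have hs : ∀ W : VField E M, (trivializationAt E (fun x : M => TangentSpace 𝓘(ℝ, E) x) θ.proj).symm η.proj (VField.coord θ.proj W η.proj) = W η.proj := by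
    intro W
    exact (trivializationAt E (fun x : M => TangentSpace 𝓘(ℝ, E) x) θ.proj).symm_apply_apply_mk  (b := η.proj) h (W η.proj)
  rw [hom_trivializationAt_apply]
  have := inCoordinates_apply_eq₂ (𝕜 := ℝ) (F₁ := E) (F₂ := E) (F₃ := ℝ) (E₁ := fun x : M => TangentSpace 𝓘(ℝ, E) x) (E₂ := fun x : M => TangentSpace 𝓘(ℝ, E) x) (E₃ := fun x : M => ℝ) (x₀ := θ.proj) (x := η.proj) (ϕ := η.2) (v := VField.coord θ.proj Y η.proj) (w := VField.coord θ.proj Z η.proj) h h (by simp)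
  refine Eq.trans ?_ this.symm
  rw [hs, hs]
  simp

theorem hasMFDerivAt_clm2 {EN HN N G : Type*} [NormedAddCommGroup EN] [NormedSpace ℝ EN] [NormedAddCommGroup G] [NormedSpace ℝ G] [TopologicalSpace HN]
  {I : ModelWithCorners ℝ EN HN} [TopologicalSpace N] [ChartedSpace HN N] {p : N → G →L[ℝ] G →L[ℝ] ℝ} {y z : N → G} {x : N}
  {p' : EN →L[ℝ] (G →L[ℝ] G →L[ℝ] ℝ)} {y' z' : EN →L[ℝ] G}
  (hp : HasMFDerivAt I 𝓘(ℝ, G →L[ℝ] G →L[ℝ] ℝ) p x p') (hy : HasMFDerivAt I 𝓘(ℝ, G) y x y') (hz : HasMFDerivAt I 𝓘(ℝ, G) z x z') :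
  ∃ D : EN →L[ℝ] ℝ, HasMFDerivAt I 𝓘(ℝ, ℝ) (fun η => p η (y η) (z η)) x D ∧ ∀ v, D v = p' v (y x) (z x) + p x (y' v) (z x) + p x (y x) (z' v) := by
  refine ⟨_, ⟨(hp.1.clm_apply hy.1).clm_apply hz.1, HasFDerivWithinAt.clm_apply (HasFDerivWithinAt.clm_apply hp.2 hy.2) hz.2⟩, ?_⟩
  intro v
  simp
  ring

/-- `L_{X⁽⁰⁾} h = 0`, evaluated on the lifts of two vector fields `Y`, `Z` on `M`. -/
theorem lie_prolong (X Y Z : VField E M) (θ : BilinBundle E M) :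
   mvfderiv (bilinModel E) (fun η : BilinBundle E M => η.2 (Y η.proj) (Z η.proj)) θ (prolong X θ)
    = θ.2 (⁅X, Y⁆ θ.proj) (Z θ.proj) + θ.2 (Y θ.proj) (⁅X, Z⁆ θ.proj) := by
  have e : (fun η : BilinBundle E M => η.2 (Y η.proj) (Z η.proj)) =ᶠ[𝓝 θ] fun η => ((trivializationAt (E →L[ℝ] E →L[ℝ] ℝ) (fun x : M => TangentSpace 𝓘(ℝ, E) x →L[ℝ] TangentSpace 𝓘(ℝ, E) x →L[ℝ] ℝ) θ.proj) η).2 (VField.coord θ.proj Y η.proj) (VField.coord θ.proj Z η.proj) := by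
    have : (TotalSpace.proj : BilinBundle E M → M) ⁻¹' (chartAt E θ.proj).source ∈ 𝓝 θ :=
      (FiberBundle.continuous_proj _ _).continuousAt.preimage_mem_nhds (chart_source_mem_nhds E _)
    filter_upwards [this] with η hη
    exact eval_eq Y Z θ η hη
  have hY := (coord_mdiff Y θ.proj).hasMFDerivAt.comp θ (hasMFDerivAt_proj (E := E) θ)
  have hZ := (coord_mdiff Z θ.proj).hasMFDerivAt.comp θ (hasMFDerivAt_proj (E := E) θ)
  have hs := hasMFDerivAt_snd (E := E) θ
  have key := hasMFDerivAt_clm2 hs hY hZ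
  obtain ⟨D, key, hD⟩ := key
  have e2 := key.congr_of_eventuallyEq e
  have e3 := e2.mfderiv
  have e4 : mvfderiv (bilinModel E) (fun η : BilinBundle E M => η.2 (Y η.proj) (Z η.proj)) θ (prolong X θ) = mfderiv (bilinModel E) 𝓘(ℝ, ℝ) (fun η : BilinBundle E M => η.2 (Y η.proj) (Z η.proj)) θ (prolong X θ) := rfl
  rw [e4, e3, bracket_coord, bracket_coord]
  refine (hD (prolong X θ)).trans ?_
  have h1 : ∀ v w : E, ((trivializationAt (E →L[ℝ] E →L[ℝ] ℝ) (fun x : M => TangentSpace 𝓘(ℝ, E) x →L[ℝ] TangentSpace 𝓘(ℝ, E) x →L[ℝ] ℝ) θ.proj) θ).2 v w = (θ.2 : E →L[ℝ] E →L[ℝ] ℝ) v w := by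
    intro v w
    have hm : θ.proj ∈ (chartAt E θ.proj).source := mem_chart_source E _
    have hs : ∀ W : E, (trivializationAt E (fun x : M => TangentSpace 𝓘(ℝ, E) x) θ.proj).symm θ.proj W = W := by
      intro W
      have h0 : (trivializationAt E (fun x : M => TangentSpace 𝓘(ℝ, E) x) θ.proj ⟨θ.proj, W⟩).2 = W := 
        (tangentBundleCore 𝓘(ℝ, E) M).coordChange_self _ _ (mem_chart_source E _) _
      have h5 := (trivializationAt E (fun x : M => TangentSpace 𝓘(ℝ, E) x) θ.proj).symm_apply_apply_mk  (b := θ.proj) hm W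
      rw [h0] at h5
      exact h5
    rw [hom_trivializationAt_apply]
    have := inCoordinates_apply_eq₂ (𝕜 := ℝ) (F₁ := E) (F₂ := E) (F₃ := ℝ) (E₁ := fun x : M => TangentSpace 𝓘(ℝ, E) x) (E₂ := fun x : M => TangentSpace 𝓘(ℝ, E) x) (E₃ := fun x : M => ℝ) (x₀ := θ.proj) (x := θ.proj) (ϕ := θ.2) (v := v) (w := w) hm hm (by simp)
    refine this.trans ?_
    rw [hs, hs]
    simp
  rw [h1, h1]
  simp only [Function.comp, coord_self]
  let B : E →L[ℝ] E →L[ℝ] ℝ := θ.2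
  let A : E →L[ℝ] E := X.coordDeriv θ.proj
  let y : E := Y θ.proj
  let z : E := Z θ.proj
  let x : E := X θ.proj
  let DY : E →L[ℝ] E := mvfderiv 𝓘(ℝ, E) (VField.coord θ.proj Y) θ.proj
  let DZ : E →L[ℝ] E := mvfderiv 𝓘(ℝ, E) (VField.coord θ.proj Z) θ.proj
  change (-(B.bilinearComp A (.id ℝ E) + B.bilinearComp (.id ℝ E) A)) y z + B (DY x) z + B y (DZ x)
    = B (DY x - A y) z + B y (DZ x - A z)
  simp
  ring

/-- `R_g = ‖K₁ ∧ … ∧ K_r‖²_g`, a function on `M`. -/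
def metricWedgeNormSq (g : LorentzMetric E M) {r : ℕ} (K : Fin r → VField E M) (a : M) : ℝ :=
  wedgeNormSq (ContinuousLinearMap.toLinearMap₁₂ (g.toFun a)) (fun i => K i a)

/-- `R = ‖K₁⁽⁰⁾ ∧ … ∧ K_r⁽⁰⁾‖²_h`, a function on the bundle of bilinear forms. -/
def wedgeInvariant {r : ℕ} (K : Fin r → VField E M) (θ : BilinBundle E M) : ℝ :=
  wedgeNormSq (horizontalForm θ) (fun i => prolong (K i) θ)

/-- The `r`-vector `K₁ ∧ … ∧ K_r` at `a`. -/
def wedgeAt {r : ℕ} (K : Fin r → VField E M) (a : M) : ⋀[ℝ]^r (TangentSpace 𝓘(ℝ, E) a) :=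
  exteriorPower.ιMulti ℝ r (fun i => K i a)

/-- The Lie derivative `L_X (K₁ ∧ … ∧ K_r) = ∑ᵢ K₁ ∧ … ∧ [X, Kᵢ] ∧ … ∧ K_r` at `a`. -/
def lieWedgeAt {r : ℕ} (X : VField E M) (K : Fin r → VField E M) (a : M) :
    ⋀[ℝ]^r (TangentSpace 𝓘(ℝ, E) a) :=
  ∑ i, wedgeAt (Function.update K i ⁅X, K i⁆) a

/-- `R` is a relative invariant of order `0` on the set `S ⊆ J⁰π`, with respect to the Lie algebra
`𝔤` of vector fields and with weight `w ∈ 𝔤*`: it is smooth and `X⁽⁰⁾(R) = w(X) R` at all points of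
`S`, for all `X ∈ 𝔤`. -/
def IsRelativeInvariantOn (𝔤 : LieSubalgebra ℝ (VField E M)) (S : Set (BilinBundle E M))
    (R : BilinBundle E M → ℝ) (w : 𝔤 →ₗ[ℝ] ℝ) : Prop :=
  ∀ θ ∈ S, ContMDiffAt (bilinModel E) 𝓘(ℝ, ℝ) ∞ R θ ∧
    ∀ X : 𝔤, mvfderiv (bilinModel E) R θ (prolong (X : VField E M) θ) = w X * R θ

section Horizon

variable {E' : Type*} [NormedAddCommGroup E'] [NormedSpace ℝ E']
  {N : Type*} [TopologicalSpace N] [ChartedSpace E' N]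

/-- `ι : N → M` is an injectively immersed hypersurface. -/
structure IsHypersurface (ι : N → M) : Prop where
  finrank_eq : Module.finrank ℝ E' + 1 = Module.finrank ℝ E
  contMDiff : ContMDiff 𝓘(ℝ, E') 𝓘(ℝ, E) ∞ ι
  injective : Function.Injective ι
  injective_mfderiv : ∀ p, Function.Injective (mfderiv 𝓘(ℝ, E') 𝓘(ℝ, E) ι p)

/-- The tangent space `T_{ι p} H ⊆ T_{ι p} M` of the hypersurface `H = ι(N)`. -/
def hypersurfaceTangent (ι : N → M) (p : N) : Submodule ℝ (TangentSpace 𝓘(ℝ, E) (ι p)) :=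
  (mfderiv 𝓘(ℝ, E') 𝓘(ℝ, E) ι p).range

/-- `H = ι(N)` is a Killing horizon of `g`: a null hypersurface (the metric induced on each of its
tangent spaces is degenerate) together with a Killing vector field that is null, tangent to `H` and
nowhere zero along `H`. -/
structure IsKillingHorizon (g : LorentzMetric E M) (ι : N → M) : Prop where
  isHypersurface : IsHypersurface (E := E) (E' := E') ι
  isNull : ∀ p, ∃ n ∈ hypersurfaceTangent (E := E) (E' := E') ι p, n ≠ 0 ∧
    ∀ v ∈ hypersurfaceTangent (E := E) (E' := E') ι p, g.toFun (ι p) n v = 0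
  exists_generator : ∃ K ∈ killingAlgebra g, ∀ p, g.toFun (ι p) (K (ι p)) (K (ι p)) = 0 ∧
    K (ι p) ∈ hypersurfaceTangent (E := E) (E' := E') ι p ∧ K (ι p) ≠ 0

/-- Every Killing vector field of `g` is tangent to `H = ι(N)`. -/
def IsKillingInvariant (g : LorentzMetric E M) (ι : N → M) : Prop :=
  ∀ X ∈ killingAlgebra g, ∀ p, X (ι p) ∈ hypersurfaceTangent (E := E) (E' := E') ι p

end Horizon

end KillingHorizons

end

open KillingHorizons
open scoped Manifold ContDiff

/- A derivation of a finite-dimensional Lie algebra preserves the radical `𝔯`, hence each `𝔯ᵢ`, its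
center and `𝔞(𝔯)`; this gives the ideal property, and `λ(X)` is the trace of `ad X` on `𝔞(𝔯)`. The
flow of `X⁽⁰⁾` preserves `h`, so the Gram matrix `P` of the `Kᵢ⁽⁰⁾` has derivative `C P + P Cᵀ`, with
`C` the matrix of `ad X`, and its determinant has logarithmic derivative `2 tr C`.

Along a `𝔨`-invariant Killing horizon with generator `K`, the Killing fields that are pointwise
multiples of `K` form an ideal `J ≠ 0` of `𝔨`. If `d(g(K, K)) = 2κ g(K, ·)` at a point of the
horizon, then `[K, [K, X]] = κ [K, X]` there for all `X ∈ J`. Hence `[K, ·]` acts on `[J, J]` at this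
point as multiplication by `κ`, so the fields in `[[J, J], [J, J]]` vanish along the horizon; a
Killing field that vanishes on a hypersurface is zero, so `J` is solvable and `J ≤ 𝔯`. A nonzero
ideal inside `𝔯` meets `𝔞(𝔯)` nontrivially, and a nonzero element of `J ∩ 𝔞(𝔯)` is orthogonal to all
Killing fields along the horizon, which makes the Gram matrix of the `Kᵢ` singular there. -/

noncomputable section

namespace KillingHorizons

open Bundle LieAlgebra Set VectorField
open scoped Topology

section Radical

variable {R L : Type*} [CommRing R] [LieRing L] [LieAlgebra R L]

theorem le_radical_of_derivedSeriesOfIdeal_eq_bot {I : LieIdeal R L} {k : ℕ}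
    (h : derivedSeriesOfIdeal R L k I = ⊥) : I ≤ radical R L :=
  le_sSup (IsSolvable.mk (R := R) ((LieIdeal.derivedSeries_eq_bot_iff I k).2 h))

theorem exists_derivedSeriesOfIdeal_radical_eq_bot [IsNoetherian R L] :
    ∃ k, derivedSeriesOfIdeal R L k (radical R L) = ⊥ := by
  obtain ⟨k, hk⟩ := (radicalIsSolvable (R := R) (L := L)).solvable (R := R)
  exact ⟨k, (LieIdeal.derivedSeries_eq_bot_iff _ k).1 hk⟩

theorem le_radical_of_lie_self_le [IsNoetherian R L] {J : LieIdeal R L}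
    (h : ⁅J, J⁆ ≤ radical R L) : J ≤ radical R L := by
  obtain ⟨k, hk⟩ := exists_derivedSeriesOfIdeal_radical_eq_bot (R := R) (L := L)
  refine le_radical_of_derivedSeriesOfIdeal_eq_bot (k := k + 1) (le_bot_iff.1 ?_)
  rw [derivedSeriesOfIdeal_add, ← hk]
  exact derivedSeriesOfIdeal_mono h k

theorem le_radical_of_forall_lie_mem [IsNoetherian R L] {V : Submodule R L}
    (hV : ∀ x : L, ∀ y ∈ V, ⁅x, y⁆ ∈ (radical R L).toSubmodule ⊔ V)
    (hV' : ∀ x ∈ V, ∀ y ∈ V, ⁅x, y⁆ ∈ radical R L) :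
    V ≤ (radical R L).toSubmodule := by
  let J : LieIdeal R L :=
    { (radical R L).toSubmodule ⊔ V with
      lie_mem := by
        intro x y hy
        obtain ⟨r, hr, v, hv, rfl⟩ := Submodule.mem_sup.1 hy
        rw [lie_add]
        exact add_mem (Submodule.mem_sup_left (LieSubmodule.lie_mem _ hr)) (hV x v hv) }
  have hJ : J ≤ radical R L := by
    refine le_radical_of_lie_self_le ?_
    rw [LieSubmodule.lieIdeal_oper_eq_span, LieSubmodule.lieSpan_le]
    rintro _ ⟨⟨x, hx⟩, ⟨y, hy⟩, rfl⟩
    obtain ⟨r, hr, v, hv, rfl⟩ := Submodule.mem_sup.1 hx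
    obtain ⟨s, hs, w, hw, rfl⟩ := Submodule.mem_sup.1 hy
    simp only [add_lie, lie_add]
    exact add_mem (add_mem (lie_mem_left _ _ _ _ _ hr) (LieSubmodule.lie_mem _ hs))
      (add_mem (lie_mem_left _ _ _ _ _ hr) (hV' v hv w hw))
  exact le_sup_right.trans hJ

end Radical

section Derivation

theorem iterate_lie_sub_choose_smul_mem {R L : Type*} [CommRing R] [LieRing L] [LieAlgebra R L]
    (D : LieDerivation R L L) {N : LieIdeal R L} {x y : L} {m n : ℕ}
    (hx : ∀ i < m, D^[i] x ∈ N) (hy : ∀ i < n, D^[i] y ∈ N) :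
    D^[m + n] ⁅x, y⁆ - (m + n).choose m • ⁅D^[m] x, D^[n] y⁆ ∈ N := by
  rw [LieDerivation.iterate_apply_lie, ← Finset.add_sum_erase _ _ (a := (m, n)) (by simp),
    add_sub_cancel_left]
  refine sum_mem fun ij hij => nsmul_mem ?_ _
  rw [Finset.mem_erase, Finset.HasAntidiagonal.mem_antidiagonal] at hij
  rcases lt_or_ge ij.1 m with hi | hi
  · exact lie_mem_left _ _ _ _ _ (hx _ hi)
  · have : ij.1 ≠ m := fun e => hij.1 (Prod.ext e (by simp only; lia))
    exact LieSubmodule.lie_mem N (hy _ (by lia))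

theorem derivation_mem_derivedSeriesOfIdeal {R L : Type*} [CommRing R] [LieRing L] [LieAlgebra R L]
    (D : LieDerivation R L L) {I : LieIdeal R L} (hI : ∀ x ∈ I, D x ∈ I) (k : ℕ) :
    ∀ x ∈ derivedSeriesOfIdeal R L k I, D x ∈ derivedSeriesOfIdeal R L k I := by
  induction k with
  | zero => exact hI
  | succ k ih =>
    rw [derivedSeriesOfIdeal_succ]
    set J := derivedSeriesOfIdeal R L k I
    have h : (⁅J, J⁆ : LieIdeal R L).toSubmodule ≤
        (⁅J, J⁆ : LieIdeal R L).toSubmodule.comap D.toLinearMap := by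
      conv_lhs => rw [LieSubmodule.lieIdeal_oper_eq_linear_span']
      rw [Submodule.span_le]
      rintro _ ⟨x, hx, y, hy, rfl⟩
      change D ⁅x, y⁆ ∈ ⁅J, J⁆
      rw [D.apply_lie_eq_add]
      exact add_mem (LieSubmodule.lie_mem_lie hx (ih y hy)) (LieSubmodule.lie_mem_lie (ih x hx) hy)
    exact h

variable {𝕜 L : Type*} [Field 𝕜] [CharZero 𝕜] [LieRing L] [LieAlgebra 𝕜 L] [IsNoetherian 𝕜 L]

/- Modulo the radical, `Dᵐ I` is an ideal by induction on `m`, and it is abelian by induction on the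
derived length of `I`: `(2m choose m) [Dᵐ x, Dᵐ y]` is congruent to `D²ᵐ [x, y]`. -/
theorem derivation_iterate_mem_radical (D : LieDerivation 𝕜 L L) {k : ℕ} {I : LieIdeal 𝕜 L}
    (hI : derivedSeriesOfIdeal 𝕜 L k I = ⊥) (m : ℕ) {x : L} (hx : x ∈ I) :
    D^[m] x ∈ radical 𝕜 L := by
  induction k generalizing I m x with
  | zero =>
    obtain rfl : I = ⊥ := hI
    rw [(LieSubmodule.mem_bot x).1 hx, iterate_map_zero]
    exact zero_mem _
  | succ k ihk =>
    have hlie {n : ℕ} {x y : L} (hx : x ∈ I) (hy : y ∈ I) : D^[n] ⁅x, y⁆ ∈ radical 𝕜 L :=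
      ihk (I := ⁅I, I⁆) ((derivedSeriesOfIdeal_add I k 1).symm.trans hI) n
        (LieSubmodule.lie_mem_lie hx hy)
    induction m using Nat.strong_induction_on generalizing x with
    | _ m ihm =>
    let V : Submodule 𝕜 L := I.toSubmodule.map ((D : L →ₗ[𝕜] L) ^ m)
    have hV {y : L} (hy : y ∈ I) : D^[m] y ∈ V :=
      ⟨y, hy, by rw [Module.End.coe_pow, LieDerivation.coeFn_coe]⟩
    refine le_radical_of_forall_lie_mem (V := V) ?_ ?_ (hV hx)
    · rintro x _ ⟨y, hy, rfl⟩
      rw [Module.End.coe_pow, LieDerivation.coeFn_coe]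
      have h := iterate_lie_sub_choose_smul_mem D (x := x) (m := 0) (by simp)
        fun i hi => ihm i hi hy
      rw [zero_add, Nat.choose_zero_right, one_smul, Function.iterate_zero_apply] at h
      rw [← sub_sub_cancel (D^[m] ⁅x, y⁆) ⁅x, D^[m] y⁆]
      exact sub_mem (Submodule.mem_sup_right (hV (LieSubmodule.lie_mem _ hy)))
        (Submodule.mem_sup_left h)
    · rintro _ ⟨x, hx, rfl⟩ _ ⟨y, hy, rfl⟩
      rw [Module.End.coe_pow, LieDerivation.coeFn_coe]
      have h := sub_mem (hlie (n := m + m) hx hy) (iterate_lie_sub_choose_smul_mem D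
        (fun i hi => ihm i hi hx) fun i hi => ihm i hi hy)
      have hc : ((m + m).choose m : 𝕜) ≠ 0 := by exact_mod_cast (Nat.choose_pos (by lia)).ne'
      rw [sub_sub_cancel, ← Nat.cast_smul_eq_nsmul 𝕜] at h
      exact (Submodule.smul_mem_iff (radical 𝕜 L).toSubmodule hc).1 h

theorem derivation_mem_radical (D : LieDerivation 𝕜 L L) {x : L} (hx : x ∈ radical 𝕜 L) :
    D x ∈ radical 𝕜 L :=
  have ⟨_, hk⟩ := exists_derivedSeriesOfIdeal_radical_eq_bot (R := 𝕜) (L := L)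
  derivation_iterate_mem_radical D hk 1 hx

end Derivation

section RadicalAbelianIdeal

variable {L : Type*} [LieRing L] [LieAlgebra ℝ L]

theorem derivation_mem_idealCenter (D : LieDerivation ℝ L L) {I : LieIdeal ℝ L}
    (hI : ∀ x ∈ I, D x ∈ I) {x : L} (hx : x ∈ idealCenter I) : D x ∈ idealCenter I := by
  refine ⟨hI x hx.1, fun y hy => ?_⟩
  have h := D.apply_lie_eq_add x y
  rw [hx.2 y hy, map_zero, hx.2 _ (hI y hy), zero_add] at h
  exact h.symm

theorem idealCenter_derivedSeriesOfIdeal_le_radicalAbelianIdeal (i : ℕ) :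
    idealCenter (derivedSeriesOfIdeal ℝ L i (radical ℝ L)) ≤ radicalAbelianIdeal L :=
  le_iSup (fun i => idealCenter (derivedSeriesOfIdeal ℝ L i (radical ℝ L))) i

theorem derivation_mem_radicalAbelianIdeal [IsNoetherian ℝ L] (D : LieDerivation ℝ L L) {x : L}
    (hx : x ∈ radicalAbelianIdeal L) : D x ∈ radicalAbelianIdeal L := by
  have h : (radicalAbelianIdeal L).toSubmodule ≤
      (radicalAbelianIdeal L).toSubmodule.comap D.toLinearMap := by
    conv_lhs => rw [radicalAbelianIdeal, LieSubmodule.iSup_toSubmodule]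
    exact iSup_le fun i y hy => idealCenter_derivedSeriesOfIdeal_le_radicalAbelianIdeal i
      (derivation_mem_idealCenter D (derivation_mem_derivedSeriesOfIdeal D
        (fun _ => derivation_mem_radical D) i) hy)
  exact h hx

theorem lie_idealCenter_derivedSeriesOfIdeal_eq_zero {I : LieIdeal ℝ L} {i j : ℕ} {x y : L}
    (hx : x ∈ idealCenter (derivedSeriesOfIdeal ℝ L i I))
    (hy : y ∈ idealCenter (derivedSeriesOfIdeal ℝ L j I)) : ⁅x, y⁆ = 0 := by
  rcases le_total i j with h | h
  · exact hx.2 y (derivedSeriesOfIdeal_antitone I h hy.1)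
  · rw [← lie_skew, hy.2 x (derivedSeriesOfIdeal_antitone I h hx.1), neg_zero]

theorem lie_radicalAbelianIdeal_eq_zero {x y : L} (hx : x ∈ radicalAbelianIdeal L)
    (hy : y ∈ radicalAbelianIdeal L) : ⁅x, y⁆ = 0 := by
  rw [radicalAbelianIdeal, ← LieSubmodule.mem_toSubmodule, LieSubmodule.iSup_toSubmodule] at hx hy
  induction hx using Submodule.iSup_induction' with
  | mem i x hx =>
    induction hy using Submodule.iSup_induction' with
    | mem j y hy => exact lie_idealCenter_derivedSeriesOfIdeal_eq_zero hx hy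
    | zero => exact lie_zero x
    | add y z _ _ ihy ihz => rw [lie_add, ihy, ihz, add_zero]
  | zero => exact zero_lie y
  | add x z _ _ ihx ihz => rw [add_lie, ihx, ihz, add_zero]

/- The last nonzero term of the sequence `𝔯ᵢ ⊓ J` lies in the center of `𝔯ᵢ`, since `[𝔯ᵢ, 𝔯ᵢ ⊓ J]`
is contained in `𝔯ᵢ₊₁ ⊓ J = 0`. -/
theorem exists_ne_zero_mem_radicalAbelianIdeal [IsNoetherian ℝ L] {J : LieIdeal ℝ L}
    (hJ : J ≤ radical ℝ L) (hne : J ≠ ⊥) : ∃ x ∈ J, x ≠ 0 ∧ x ∈ radicalAbelianIdeal L := by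
  let 𝔯 (i : ℕ) : LieIdeal ℝ L := derivedSeriesOfIdeal ℝ L i (radical ℝ L)
  have h0 : 𝔯 0 ⊓ J ≠ ⊥ := (inf_eq_right.2 hJ).trans_ne hne
  obtain ⟨l, hl⟩ : ∃ l, 𝔯 l = ⊥ := exists_derivedSeriesOfIdeal_radical_eq_bot
  obtain ⟨i, hi, hi'⟩ : ∃ i, 𝔯 i ⊓ J ≠ ⊥ ∧ 𝔯 (i + 1) ⊓ J = ⊥ := by
    by_contra! h
    have (i : ℕ) : 𝔯 i ⊓ J ≠ ⊥ := Nat.rec h0 h i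
    exact this l (by rw [hl, bot_inf_eq])
  obtain ⟨x, hx, hx0⟩ : ∃ x ∈ 𝔯 i ⊓ J, x ≠ 0 := by
    simpa only [ne_eq, LieSubmodule.eq_bot_iff, not_forall, exists_prop] using hi
  rw [LieSubmodule.mem_inf] at hx
  refine ⟨x, hx.2, hx0, idealCenter_derivedSeriesOfIdeal_le_radicalAbelianIdeal i
    ⟨hx.1, fun y hy => ?_⟩⟩
  rw [← LieSubmodule.mem_bot (R := ℝ) (L := L), ← hi', LieSubmodule.mem_inf]
  exact ⟨(derivedSeriesOfIdeal_succ ..).ge (LieSubmodule.lie_mem_lie hx.1 hy),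
    lie_mem_left _ _ _ _ _ hx.2⟩

end RadicalAbelianIdeal

section Determinant

variable {n : Type*} [Fintype n] [DecidableEq n]

theorem sum_det_updateRow {R : Type*} [CommRing R] (P B : Matrix n n R) :
    ∑ i, (P.updateRow i (B i)).det = (P.adjugate * B).trace := by
  simp only [← Matrix.cramer_transpose_apply, Matrix.cramer_eq_adjugate_mulVec,
    ← Matrix.adjugate_transpose, Matrix.trace, Matrix.diag, Matrix.mul_apply]
  exact Finset.sum_comm

theorem trace_adjugate_mul_add_mul_transpose {R : Type*} [CommRing R] (P C : Matrix n n R) :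
    (P.adjugate * (C * P + P * C.transpose)).trace = 2 * C.trace * P.det := by
  rw [Matrix.mul_add, Matrix.trace_add, ← Matrix.mul_assoc, Matrix.trace_mul_comm,
    ← Matrix.mul_assoc, ← Matrix.mul_assoc, Matrix.mul_adjugate, Matrix.adjugate_mul,
    Matrix.smul_mul, Matrix.smul_mul, Matrix.one_mul, Matrix.one_mul, Matrix.trace_smul,
    Matrix.trace_smul, Matrix.trace_transpose, smul_eq_mul]
  ring

variable {E H N : Type*} [NormedAddCommGroup E] [NormedSpace ℝ E] [TopologicalSpace H]
  {I : ModelWithCorners ℝ E H} [TopologicalSpace N] [ChartedSpace H N]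

theorem hasMFDerivAt_det {φ : N → Matrix n n ℝ} {φ' : n → n → E →L[ℝ] ℝ} {x : N}
    (h : ∀ i j, HasMFDerivAt I 𝓘(ℝ, ℝ) (fun y => φ y i j) x (φ' i j)) :
    ∃ D : E →L[ℝ] ℝ, HasMFDerivAt I 𝓘(ℝ, ℝ) (fun y => (φ y).det) x D ∧
      ∀ v, D v = ((φ x).adjugate * Matrix.of fun i j => φ' i j v).trace := by
  let det : ContinuousMultilinearMap ℝ (fun _ : n => n → ℝ) ℝ :=
    ⟨Matrix.detRowAlternating.toMultilinearMap, Continuous.matrix_det continuous_id⟩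
  let Φ : E →L[ℝ] (n → n → ℝ) := .pi fun i => .pi (φ' i)
  have hφ : HasMFDerivAt I 𝓘(ℝ, n → n → ℝ) (fun y i j => φ y i j) x Φ :=
    ⟨continuousAt_pi.2 fun i => continuousAt_pi.2 fun j => (h i j).1,
      hasFDerivWithinAt_pi.2 fun i => hasFDerivWithinAt_pi.2 fun j => (h i j).2⟩
  have hdet : HasMFDerivAt 𝓘(ℝ, n → n → ℝ) 𝓘(ℝ, ℝ) det (fun i j => φ x i j)
      (det.linearDeriv fun i j => φ x i j) := (det.hasFDerivAt _).hasMFDerivAt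
  refine ⟨_, HasMFDerivAt.comp (f := fun y i j => φ y i j) x hdet hφ, fun v => ?_⟩
  rw [← sum_det_updateRow]
  exact det.linearDeriv_apply (fun i j => φ x i j) (Φ v)

end Determinant

theorem sum_alternatingMap_update_sum_smul {R V W ι : Type*} [CommRing R] [AddCommGroup V]
    [Module R V] [AddCommGroup W] [Module R W] [Fintype ι] [DecidableEq ι] (f : V [⋀^ι]→ₗ[R] W)
    (v : ι → V) (C : Matrix ι ι R) :
    ∑ i, f (Function.update v i (∑ k, C i k • v k)) = C.trace • f v := by
  simp only [Matrix.trace, Matrix.diag, Finset.sum_smul]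
  refine Finset.sum_congr rfl fun i _ => ?_
  rw [AlternatingMap.map_update_sum, Finset.sum_eq_single i]
  · rw [AlternatingMap.map_update_smul, Function.update_eq_self]
  · intro k _ hk
    rw [AlternatingMap.map_update_smul, AlternatingMap.map_update_self _ _ hk.symm, smul_zero]
  · simp

theorem wedgeNormSq_eq_det {V : Type*} [AddCommGroup V] [Module ℝ V] (B : V →ₗ[ℝ] V →ₗ[ℝ] ℝ)
    {r : ℕ} (v : Fin r → V) :
    wedgeNormSq B v = (Matrix.of fun i j => B (v j) (v i)).det := by
  simp only [wedgeNormSq, exteriorForm, LinearMap.comp_apply, exteriorPower.map_apply_ιMulti]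
  exact exteriorPower.pairingDual_ιMulti_ιMulti ..

section Wedge

variable {E : Type*} [NormedAddCommGroup E] [NormedSpace ℝ E]
  {M : Type*} [TopologicalSpace M] [ChartedSpace E M] [IsManifold 𝓘(ℝ, E) ∞ M]

/-- Evaluation at `a` as a linear map on vector fields. -/
def VField.evalAt (a : M) : VField E M →ₗ[ℝ] TangentSpace 𝓘(ℝ, E) a where
  toFun X := X a
  map_add' _ _ := rfl
  map_smul' _ _ := rfl

theorem VField.sum_smul_apply {ι : Type*} (s : Finset ι) (c : ι → ℝ) (K : ι → VField E M) (a : M) :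
    (∑ k ∈ s, c k • K k) a = ∑ k ∈ s, c k • K k a := by
  exact (map_sum (VField.evalAt a) ..).trans (by simp only [map_smul]; rfl)

variable {r : ℕ} {K : Fin r → VField E M}

theorem metricWedgeNormSq_eq_det (g : LorentzMetric E M) (K : Fin r → VField E M) (a : M) :
    metricWedgeNormSq g K a = (Matrix.of fun i j => g.toFun a (K j a) (K i a)).det :=
  wedgeNormSq_eq_det ..

theorem metricWedgeNormSq_eq_zero_of_sum_smul {g : LorentzMetric E M} {a : M} {c : Fin r → ℝ}
    (hc : c ≠ 0) (horth : ∀ i, g.toFun a (∑ j, c j • K j a) (K i a) = 0) :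
    metricWedgeNormSq g K a = 0 := by
  rw [metricWedgeNormSq_eq_det, ← Matrix.exists_mulVec_eq_zero_iff]
  refine ⟨c, hc, funext fun i => Eq.trans ?_ (horth i)⟩
  simp only [Matrix.mulVec, dotProduct, Matrix.of_apply, map_sum, sum_apply, map_smul, smul_apply,
    smul_eq_mul, mul_comm]

theorem VField.contMDiffAt_coord (Y : VField E M) (a : M) :
    ContMDiffAt 𝓘(ℝ, E) 𝓘(ℝ, E) ∞ (VField.coord a Y) a :=
  (contMDiffAt_totalSpace.1 (Y.contMDiff a)).2

variable [FiniteDimensional ℝ E] (K)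

theorem wedgeInvariant_eq_det (θ : BilinBundle E M) :
    wedgeInvariant K θ = (Matrix.of fun i j => θ.2 (K j θ.proj) (K i θ.proj)).det := by
  rw [wedgeInvariant, wedgeNormSq_eq_det]
  congr! with i j
  rw [horizontalForm, LinearMap.compl₁₂_apply]
  exact congrArg₂ (fun v w => θ.2 v w) (proj_prolong ..) (proj_prolong ..)

theorem contMDiff_bilinBundle_apply (Y Z : VField E M) :
    ContMDiff (bilinModel E) 𝓘(ℝ, ℝ) ∞
      (fun η : BilinBundle E M => η.2 (Y η.proj) (Z η.proj)) := by
  intro θ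
  have hθ := (contMDiffAt_totalSpace.1 (contMDiffAt_id (I := bilinModel E) (n := ∞) (x := θ))).2
  have hcoord (W : VField E M) : ContMDiffAt (bilinModel E) 𝓘(ℝ, E) ∞
      (fun η : BilinBundle E M => VField.coord θ.proj W η.proj) θ :=
    (W.contMDiffAt_coord θ.proj).comp θ (contMDiffAt_proj _)
  refine ((hθ.clm_apply (hcoord Y)).clm_apply (hcoord Z)).congr_of_eventuallyEq ?_
  filter_upwards [(FiberBundle.continuous_proj _ _).continuousAt.preimage_mem_nhds
    (chart_source_mem_nhds E θ.proj)] with η hη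
  exact eval_eq Y Z θ η hη

theorem contMDiff_wedgeInvariant :
    ContMDiff (bilinModel E) 𝓘(ℝ, ℝ) ∞ (wedgeInvariant K) := by
  simp only [funext (wedgeInvariant_eq_det K), Matrix.det_apply', Matrix.of_apply]
  exact contMDiff_finsetSum fun σ _ => contMDiff_const.mul
    (contMDiff_finsetProd fun i _ => contMDiff_bilinBundle_apply _ _)

variable {K} {X : VField E M} {C : Matrix (Fin r) (Fin r) ℝ}

theorem mvfderiv_wedgeInvariant (hC : ∀ i, ⁅X, K i⁆ = ∑ k, C i k • K k) (θ : BilinBundle E M) :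
    mvfderiv (bilinModel E) (wedgeInvariant K) θ (prolong X θ) =
      2 * C.trace * wedgeInvariant K θ := by
  let P (η : BilinBundle E M) : Matrix (Fin r) (Fin r) ℝ :=
    .of fun i j => η.2 (K j η.proj) (K i η.proj)
  obtain ⟨D, hD, hD'⟩ := hasMFDerivAt_det (φ := P) fun i j =>
    ((contMDiff_bilinBundle_apply (K j) (K i) θ).mdifferentiableAt (by simp)).hasMFDerivAt
  have hP : (Matrix.of fun i j => mvfderiv (bilinModel E) (fun η => P η i j) θ (prolong X θ)) =
      C * P θ + P θ * C.transpose := by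
    ext i j
    have hlie (i) : ⁅X, K i⁆ θ.proj = ∑ k, C i k • K k θ.proj := by rw [hC, VField.sum_smul_apply]
    refine (lie_prolong X (K j) (K i) θ).trans ?_
    rw [hlie, hlie]
    simp [P, Matrix.mul_apply, mul_comm, add_comm]
  calc mvfderiv (bilinModel E) (wedgeInvariant K) θ (prolong X θ)
    _ = D (prolong X θ) := by
      rw [funext (wedgeInvariant_eq_det K)]
      exact congrArg (· (prolong X θ)) hD.mfderiv
    _ = ((P θ).adjugate * (C * P θ + P θ * C.transpose)).trace :=
      (hD' _).trans (congrArg (fun Q => ((P θ).adjugate * Q).trace) hP)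
    _ = 2 * C.trace * wedgeInvariant K θ := by
      rw [trace_adjugate_mul_add_mul_transpose, wedgeInvariant_eq_det]

theorem lieWedgeAt_eq_trace_smul (hC : ∀ i, ⁅X, K i⁆ = ∑ k, C i k • K k) (a : M) :
    lieWedgeAt X K a = C.trace • wedgeAt K a := by
  rw [wedgeAt, ← sum_alternatingMap_update_sum_smul]
  refine Finset.sum_congr rfl fun i _ => congrArg _ (funext fun j => ?_)
  rcases eq_or_ne j i with rfl | h
  · simp only [Function.update_self, hC, VField.sum_smul_apply]
  · simp only [Function.update_of_ne h]

end Wedge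

section UniqueContinuation

variable {E F : Type*} [NormedAddCommGroup E] [NormedSpace ℝ E]
  [NormedAddCommGroup F] [NormedSpace ℝ F]

theorem eventually_eq_zero_of_norm_fderiv_le {f : E → F} {z₀ : E} {C : ℝ}
    (hf : ∀ᶠ z in 𝓝 z₀, DifferentiableAt ℝ f z)
    (hC : ∀ᶠ z in 𝓝 z₀, ‖fderiv ℝ f z‖ ≤ C * ‖f z‖) (h0 : f z₀ = 0) :
    ∀ᶠ z in 𝓝 z₀, f z = 0 := by
  obtain ⟨ε, hε, hball⟩ := Metric.eventually_nhds_iff_ball.1 (hf.and hC)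
  filter_upwards [Metric.ball_mem_nhds z₀ hε] with z hz
  let γ : ℝ → E := AffineMap.lineMap z₀ z
  have hγ : ∀ t ∈ Icc (0 : ℝ) 1, γ t ∈ Metric.ball z₀ ε := fun t ht =>
    (convex_ball z₀ ε).lineMap_mem (Metric.mem_ball_self hε) hz ht
  have hfγ : ∀ t ∈ Icc (0 : ℝ) 1, HasDerivAt (f ∘ γ) (fderiv ℝ f (γ t) (z - z₀)) t := fun t ht =>
    (hball _ (hγ t ht)).1.hasFDerivAt.comp_hasDerivAt t AffineMap.hasDerivAt_lineMap
  have hbound : ∀ t ∈ Ico (0 : ℝ) 1,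
      ‖fderiv ℝ f (γ t) (z - z₀)‖ ≤ C * ‖z - z₀‖ * ‖(f ∘ γ) t‖ := fun t ht =>
    ((fderiv ℝ f (γ t)).le_of_opNorm_le (hball _ (hγ t (Ico_subset_Icc_self ht))).2 _).trans_eq
      (mul_right_comm ..)
  have hzero := eq_zero_of_abs_deriv_le_mul_abs_self_of_eq_zero_right
    (fun t ht => (hfγ t ht).continuousAt.continuousWithinAt)
    (fun t ht => (hfγ t (Ico_subset_Icc_self ht)).hasDerivWithinAt) (by simp [γ, h0]) hbound
    1 (right_mem_Icc.2 zero_le_one)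
  simpa [γ] using hzero

theorem eventually_eq_zero_of_norm_fderiv_fderiv_le {x : E → F} {z₀ : E} {C : ℝ}
    (hx : ContDiffAt ℝ 2 x z₀)
    (hC : ∀ᶠ z in 𝓝 z₀, ‖fderiv ℝ (fderiv ℝ x) z‖ ≤ C * ‖(x z, fderiv ℝ x z)‖)
    (h0 : x z₀ = 0) (h1 : fderiv ℝ x z₀ = 0) : ∀ᶠ z in 𝓝 z₀, x z = 0 := by
  have hjet : ∀ᶠ z in 𝓝 z₀, HasFDerivAt (fun z => (x z, fderiv ℝ x z))
      ((fderiv ℝ x z).prod (fderiv ℝ (fderiv ℝ x) z)) z := by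
    filter_upwards [hx.eventually (by simp)] with z hz
    exact (hz.differentiableAt (by simp)).hasFDerivAt.prodMk
      ((hz.fderiv_right (m := 1) (by norm_num)).differentiableAt (by simp)).hasFDerivAt
  refine (eventually_eq_zero_of_norm_fderiv_le (C := max 1 C)
    (hjet.mono fun z hz => hz.differentiableAt) ?_ (Prod.ext h0 h1)).mono fun z hz =>
      congrArg Prod.fst hz
  filter_upwards [hjet, hC] with z hz hCz
  rw [hz.fderiv, ContinuousLinearMap.opNorm_prod]
  refine norm_prod_le_iff.2 ⟨?_, ?_⟩
  · exact (norm_snd_le (x z, fderiv ℝ x z)).trans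
      (le_mul_of_one_le_left (norm_nonneg _) (le_max_left _ _))
  · exact hCz.trans (mul_le_mul_of_nonneg_right (le_max_right _ _) (norm_nonneg _))

end UniqueContinuation

-- The polarization by which the Koszul formula recovers a connection from a metric.
theorem abs_le_of_abs_add_le_of_symm {E : Type*} [NormedAddCommGroup E] {S : E → E → E → ℝ}
    {c : ℝ} (hsymm : ∀ w u v, S w u v = S u w v)
    (h : ∀ w u v, |S w u v + S w v u| ≤ c * (‖w‖ * ‖u‖ * ‖v‖)) (w u v : E) :
    |S w u v| ≤ 3 / 2 * c * (‖w‖ * ‖u‖ * ‖v‖) := by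
  have hwu := abs_le.1 (h w u v)
  have hvw := abs_le.1 ((h v w u).trans_eq (by ring : _ = c * (‖w‖ * ‖u‖ * ‖v‖)))
  have huv := abs_le.1 ((h u v w).trans_eq (by ring : _ = c * (‖w‖ * ‖u‖ * ‖v‖)))
  rw [hsymm v w, hsymm v u] at hvw
  rw [hsymm u w] at huv
  rw [abs_le]
  constructor <;> linarith

section FlatKilling

set_option maxSynthPendingDepth 4

variable {E : Type*} [NormedAddCommGroup E] [NormedSpace ℝ E]

/-- The Lie derivative `(L_x G)(u, v)` at `z` of a field `G` of bilinear forms on a vector space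
along the vector field `x`. -/
def flatKilling (G : E → E →L[ℝ] E →L[ℝ] ℝ) (x : E → E) (u v z : E) : ℝ :=
  fderiv ℝ G z (x z) u v + G z (fderiv ℝ x z u) v + G z u (fderiv ℝ x z v)

theorem fderiv_flatKilling {G : E → E →L[ℝ] E →L[ℝ] ℝ} {x : E → E} {z : E}
    (hG : ContDiffAt ℝ 2 G z) (hx : ContDiffAt ℝ 2 x z) (u v w : E) :
    fderiv ℝ (flatKilling G x u v) z w =
      (fderiv ℝ (fderiv ℝ G) z w (x z) u v + fderiv ℝ G z (fderiv ℝ x z w) u v +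
        fderiv ℝ G z w (fderiv ℝ x z u) v + fderiv ℝ G z w u (fderiv ℝ x z v)) +
      (G z (fderiv ℝ (fderiv ℝ x) z w u) v + G z u (fderiv ℝ (fderiv ℝ x) z w v)) := by
  have hG1 := (hG.differentiableAt (by simp)).hasFDerivAt
  have hx1 := (hx.differentiableAt (by simp)).hasFDerivAt
  have hG2 := ((hG.fderiv_right (m := 1) (by norm_num)).differentiableAt (by simp)).hasFDerivAt
  have hx2 := ((hx.fderiv_right (m := 1) (by norm_num)).differentiableAt (by simp)).hasFDerivAt
  have hconst (c : E) : HasFDerivAt (fun _ : E => c) (0 : E →L[ℝ] E) z := hasFDerivAt_const c z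
  have h := (((hG2.clm_apply hx1).clm_apply (hconst u)).clm_apply (hconst v)).add
    (((hG1.clm_apply (hx2.clm_apply (hconst u))).clm_apply (hconst v)).add
      ((hG1.clm_apply (hconst u)).clm_apply (hx2.clm_apply (hconst v))))
  rw [HasFDerivAt.fderiv (f := flatKilling G x u v)
    (h.congr_of_eventuallyEq (Filter.Eventually.of_forall fun z => add_assoc _ _ _))]
  simp only [ContinuousLinearMap.comp_zero, ContinuousLinearMap.flip_add, add_apply, zero_add,
    ContinuousLinearMap.flip_apply, ContinuousLinearMap.comp_apply]
  ring

theorem exists_norm_le_of_nondegenerate [FiniteDimensional ℝ E] {G : E → E →L[ℝ] E →L[ℝ] ℝ}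
    {z₀ : E} (hG : ContinuousAt G z₀) (hn : ∀ u, (∀ v, G z₀ u v = 0) → u = 0) :
    ∃ c : ℝ, 0 < c ∧ ∀ᶠ z in 𝓝 z₀, ∀ u, ‖u‖ ≤ c * ‖G z u‖ := by
  obtain ⟨K, hK, hKl⟩ := (G z₀).toLinearMap.exists_antilipschitzWith
    (LinearMap.ker_eq_bot'.2 fun u hu => hn u fun v => by
      rw [show G z₀ u = 0 from hu, zero_apply])
  refine ⟨2 * K, by positivity, ?_⟩
  filter_upwards [Metric.continuousAt_iff'.1 hG (1 / (2 * K)) (by positivity)] with z hz u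
  rw [dist_eq_norm] at hz
  have hGu : ‖G z₀ u‖ ≤ ‖G z u‖ + 1 / (2 * K) * ‖u‖ :=
    calc ‖G z₀ u‖ = ‖G z u - (G z - G z₀) u‖ := by simp
      _ ≤ ‖G z u‖ + ‖(G z - G z₀) u‖ := norm_sub_le _ _
      _ ≤ _ := by gcongr; exact (G z - G z₀).le_of_opNorm_le hz.le u
  have hu : ‖u‖ ≤ K * ‖G z u‖ + ‖u‖ / 2 :=
    calc ‖u‖ ≤ K * ‖G z₀ u‖ := hKl.le_mul_norm (map_zero _) u
      _ ≤ K * (‖G z u‖ + 1 / (2 * K) * ‖u‖) := by gcongr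
      _ = K * ‖G z u‖ + ‖u‖ / 2 := by field_simp
  linarith

theorem norm_apply₃_le {D : E →L[ℝ] E →L[ℝ] E →L[ℝ] ℝ} {C : ℝ} (hD : ‖D‖ ≤ C) (u v w : E) :
    ‖D u v w‖ ≤ C * ‖u‖ * ‖v‖ * ‖w‖ :=
  ((D u v).le_of_opNorm_le ((D u).le_of_opNorm_le (D.le_of_opNorm_le hD u) v) w)

theorem norm_fderiv_fderiv_le_of_fderiv_flatKilling_eq_zero {G : E → E →L[ℝ] E →L[ℝ] ℝ}
    {x : E → E} {z : E} {c C : ℝ} (hG : ContDiffAt ℝ 2 G z) (hx : ContDiffAt ℝ 2 x z)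
    (hs : ∀ u v, G z u v = G z v u) (hn : ∀ u, ‖u‖ ≤ c * ‖G z u‖) (hc : 0 ≤ c)
    (hC₁ : ‖fderiv ℝ G z‖ ≤ C) (hC₂ : ‖fderiv ℝ (fderiv ℝ G) z‖ ≤ C)
    (hK : ∀ u v, fderiv ℝ (flatKilling G x u v) z = 0) :
    ‖fderiv ℝ (fderiv ℝ x) z‖ ≤ c * (6 * C) * ‖(x z, fderiv ℝ x z)‖ := by
  set y := ‖(x z, fderiv ℝ x z)‖
  have hy (p : E) : ‖fderiv ℝ x z p‖ ≤ y * ‖p‖ :=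
    (fderiv ℝ x z).le_of_opNorm_le (norm_snd_le (x z, fderiv ℝ x z)) p
  have hC : 0 ≤ C := (norm_nonneg _).trans hC₁
  let S (w u v : E) : ℝ := G z (fderiv ℝ (fderiv ℝ x) z w u) v
  have hsymm (w u v : E) : S w u v = S u w v := by
    simp only [S, (hx.isSymmSndFDerivAt (by simp)).eq w u]
  have hS (w u v : E) : |S w u v + S w v u| ≤ 4 * C * y * (‖w‖ * ‖u‖ * ‖v‖) := by
    have h := congrArg (· w) (hK u v)
    simp only [fderiv_flatKilling hG hx, hs u, zero_apply, add_eq_zero_iff_neg_eq] at h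
    have h₁ : ‖fderiv ℝ (fderiv ℝ G) z w (x z) u v‖ ≤ C * ‖w‖ * y * ‖u‖ * ‖v‖ := by
      refine (norm_apply₃_le ((fderiv ℝ (fderiv ℝ G) z).le_of_opNorm_le hC₂ w) _ _ _).trans ?_
      gcongr
      exact norm_fst_le (x z, fderiv ℝ x z)
    have h₂ : ‖fderiv ℝ G z (fderiv ℝ x z w) u v‖ ≤ C * (y * ‖w‖) * ‖u‖ * ‖v‖ :=
      (norm_apply₃_le hC₁ _ _ _).trans (by gcongr; exact hy w)
    have h₃ : ‖fderiv ℝ G z w (fderiv ℝ x z u) v‖ ≤ C * ‖w‖ * (y * ‖u‖) * ‖v‖ :=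
      (norm_apply₃_le hC₁ _ _ _).trans (by gcongr; exact hy u)
    have h₄ : ‖fderiv ℝ G z w u (fderiv ℝ x z v)‖ ≤ C * ‖w‖ * ‖u‖ * (y * ‖v‖) :=
      (norm_apply₃_le hC₁ _ _ _).trans (by gcongr; exact hy v)
    rw [show S w u v + S w v u = _ from h.symm, abs_neg, ← Real.norm_eq_abs]
    refine norm_add₄_le.trans ?_
    linarith
  have hGS (w u : E) : ‖G z (fderiv ℝ (fderiv ℝ x) z w u)‖ ≤ 6 * C * y * (‖w‖ * ‖u‖) :=
    ContinuousLinearMap.opNorm_le_bound _ (by positivity) fun v =>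
      (abs_le_of_abs_add_le_of_symm hsymm hS w u v).trans_eq (by ring)
  refine ContinuousLinearMap.opNorm_le_bound₂ _ (by positivity) fun w u => (hn _).trans ?_
  calc c * ‖G z (fderiv ℝ (fderiv ℝ x) z w u)‖ ≤ c * (6 * C * y * (‖w‖ * ‖u‖)) := by
        gcongr
        exact hGS w u
    _ = _ := by ring

theorem eventually_eq_zero_of_flatKilling_eq_zero [FiniteDimensional ℝ E]
    {G : E → E →L[ℝ] E →L[ℝ] ℝ} {x : E → E} {z₀ : E}
    (hG : ContDiffAt ℝ 2 G z₀) (hx : ContDiffAt ℝ 2 x z₀)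
    (hn : ∀ u, (∀ v, G z₀ u v = 0) → u = 0) (hs : ∀ᶠ z in 𝓝 z₀, ∀ u v, G z u v = G z v u)
    (hK : ∀ᶠ z in 𝓝 z₀, ∀ u v, flatKilling G x u v z = 0)
    (h0 : x z₀ = 0) (h1 : fderiv ℝ x z₀ = 0) : ∀ᶠ z in 𝓝 z₀, x z = 0 := by
  obtain ⟨c, hc0, hc⟩ := exists_norm_le_of_nondegenerate hG.continuousAt hn
  have hG₁ : ContDiffAt ℝ 1 (fderiv ℝ G) z₀ := hG.fderiv_right (by norm_num)
  have hG₂ : ContDiffAt ℝ 0 (fderiv ℝ (fderiv ℝ G)) z₀ := hG₁.fderiv_right (by norm_num)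
  refine eventually_eq_zero_of_norm_fderiv_fderiv_le hx ?_ h0 h1
    (C := c * (6 * max (‖fderiv ℝ G z₀‖ + 1) (‖fderiv ℝ (fderiv ℝ G) z₀‖ + 1)))
  filter_upwards [hc,
    hG₁.continuousAt.norm.eventually_lt continuousAt_const (lt_add_one _),
    hG₂.continuousAt.norm.eventually_lt continuousAt_const (lt_add_one _), hG.eventually (by simp),
    hx.eventually (by simp), hs, eventually_eventually_nhds.2 hK] with z hc hC₁ hC₂ hG hx hs hK
  refine norm_fderiv_fderiv_le_of_fderiv_flatKilling_eq_zero hG hx hs hc hc0.le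
    (hC₁.le.trans (le_max_left _ _)) (hC₂.le.trans (le_max_right _ _)) fun u v => ?_
  have hconst : flatKilling G x u v =ᶠ[𝓝 z] fun _ => 0 := hK.mono fun z hz => hz u v
  rw [hconst.fderiv_eq, fderiv_const_apply]

end FlatKilling

theorem IsLorentzForm.eq_zero_of_forall {V : Type*} [AddCommGroup V] [Module ℝ V]
    [TopologicalSpace V] {B : V →L[ℝ] V →L[ℝ] ℝ} (hB : IsLorentzForm B) {u : V}
    (hu : ∀ v, B u v = 0) : u = 0 := by
  obtain ⟨hsymm, t, -, hpos⟩ := hB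
  by_contra hne
  exact (hpos u (by rw [hsymm, hu]) hne).ne' (hu u)

section Chart

variable {E : Type*} [NormedAddCommGroup E] [NormedSpace ℝ E]
  {M : Type*} [TopologicalSpace M] [ChartedSpace E M]

theorem extChartAt_symm_mem_chart_source {a : M} {z : E} (hz : z ∈ (extChartAt 𝓘(ℝ, E) a).target) :
    (extChartAt 𝓘(ℝ, E) a).symm z ∈ (chartAt E a).source := by
  simpa only [extChartAt_source] using (extChartAt 𝓘(ℝ, E) a).map_target hz

variable [IsManifold 𝓘(ℝ, E) ∞ M]

theorem contDiffAt_comp_extChartAt_symm {F : Type*} [NormedAddCommGroup F] [NormedSpace ℝ F]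
    {f : M → F} {a : M} {z : E} (hz : z ∈ (extChartAt 𝓘(ℝ, E) a).target)
    (hf : ContMDiffAt 𝓘(ℝ, E) 𝓘(ℝ, F) ∞ f ((extChartAt 𝓘(ℝ, E) a).symm z)) :
    ContDiffAt ℝ ∞ (f ∘ (extChartAt 𝓘(ℝ, E) a).symm) z :=
  (hf.comp z ((contMDiffOn_extChartAt_symm a).contMDiffAt
    ((isOpen_extChartAt_target a).mem_nhds hz))).contDiffAt

/-- The components of the vector field `X` in the preferred chart at `a`, as a function of the
coordinates. -/
def VField.inChart (a : M) (X : VField E M) : E → E :=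
  VField.coord a X ∘ (extChartAt 𝓘(ℝ, E) a).symm

variable {X : VField E M} {a : M} {z : E}

theorem VField.contDiffAt_inChart (X : VField E M) (hz : z ∈ (extChartAt 𝓘(ℝ, E) a).target) :
    ContDiffAt ℝ ∞ (VField.inChart a X) z :=
  contDiffAt_comp_extChartAt_symm hz
    (((trivializationAt E (fun x : M => TangentSpace 𝓘(ℝ, E) x) a).contMDiffAt_section_iff
      (extChartAt_symm_mem_chart_source hz)).1 (X.contMDiff _))

theorem isInvertible_mfderiv_extChartAt_symm (hz : z ∈ (extChartAt 𝓘(ℝ, E) a).target) :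
    (mfderiv 𝓘(ℝ, E) 𝓘(ℝ, E) (extChartAt 𝓘(ℝ, E) a).symm z).IsInvertible := by
  simpa only [ModelWithCorners.Boundaryless.range_eq_univ, mfderivWithin_univ] using
    isInvertible_mfderivWithin_extChartAt_symm (I := 𝓘(ℝ, E)) hz

/-- The components of the metric `g` in the preferred chart at `a`, as a function of the
coordinates. -/
def LorentzMetric.inChart (g : LorentzMetric E M) (a : M) : E → E →L[ℝ] E →L[ℝ] ℝ :=
  (fun b => (trivializationAt (E →L[ℝ] E →L[ℝ] ℝ) (fun x : M => TangentSpace 𝓘(ℝ, E) x →L[ℝ]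
    TangentSpace 𝓘(ℝ, E) x →L[ℝ] ℝ) a (g.toSection b)).2) ∘ (extChartAt 𝓘(ℝ, E) a).symm

set_option maxSynthPendingDepth 3 in
theorem LorentzMetric.contDiffAt_inChart (g : LorentzMetric E M)
    (hz : z ∈ (extChartAt 𝓘(ℝ, E) a).target) : ContDiffAt ℝ ∞ (g.inChart a) z :=
  have hb := extChartAt_symm_mem_chart_source hz
  contDiffAt_comp_extChartAt_symm hz
    (((trivializationAt (E →L[ℝ] E →L[ℝ] ℝ) (fun x : M => TangentSpace 𝓘(ℝ, E) x →L[ℝ]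
      TangentSpace 𝓘(ℝ, E) x →L[ℝ] ℝ) a).contMDiffAt_section_iff ⟨hb, hb, mem_univ _⟩).1
      (g.contMDiff _))

variable [FiniteDimensional ℝ E]

theorem VField.mfderiv_extChartAt_symm_inChart (X : VField E M)
    (hz : z ∈ (extChartAt 𝓘(ℝ, E) a).target) :
    mfderiv 𝓘(ℝ, E) 𝓘(ℝ, E) (extChartAt 𝓘(ℝ, E) a).symm z (VField.inChart (E := E) a X z) =
      X ((extChartAt 𝓘(ℝ, E) a).symm z) := by
  have hinv := mfderivWithin_extChartAt_symm_comp_mfderiv_extChartAt (I := 𝓘(ℝ, E)) hz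
  rw [ModelWithCorners.Boundaryless.range_eq_univ, mfderivWithin_univ] at hinv
  have hcoord := coord_eq X a _ (extChartAt_symm_mem_chart_source hz)
  exact (congrArg _ hcoord).trans congr($hinv (X ((extChartAt 𝓘(ℝ, E) a).symm z)))

theorem mvfderiv_extChartAt_symm {F : Type*} [NormedAddCommGroup F] [NormedSpace ℝ F] {f : M → F}
    (X : VField E M) (hz : z ∈ (extChartAt 𝓘(ℝ, E) a).target)
    (hf : MDiffAt f ((extChartAt 𝓘(ℝ, E) a).symm z)) :
    mvfderiv 𝓘(ℝ, E) f ((extChartAt 𝓘(ℝ, E) a).symm z) (X ((extChartAt 𝓘(ℝ, E) a).symm z)) =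
      fderiv ℝ (f ∘ (extChartAt 𝓘(ℝ, E) a).symm) z (VField.inChart a X z) := by
  have hsymm : MDiffAt (extChartAt 𝓘(ℝ, E) a).symm z :=
    ((contMDiffOn_extChartAt_symm (n := ∞) a).contMDiffAt
      ((isOpen_extChartAt_target a).mem_nhds hz)).mdifferentiableAt (by simp)
  rw [← mfderiv_eq_fderiv, mfderiv_comp z hf hsymm]
  exact congrArg (mvfderiv 𝓘(ℝ, E) f _) (X.mfderiv_extChartAt_symm_inChart hz).symm

theorem VField.mpullback_extChartAt_symm (X : VField E M)
    (hz : z ∈ (extChartAt 𝓘(ℝ, E) a).target) :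
    mpullback 𝓘(ℝ, E) 𝓘(ℝ, E) (extChartAt 𝓘(ℝ, E) a).symm (fun b => X b) z =
      VField.inChart (E := E) a X z :=
  (isInvertible_mfderiv_extChartAt_symm hz).inverse_apply_eq.2
    (X.mfderiv_extChartAt_symm_inChart hz).symm

theorem VField.inChart_lie (X Y : VField E M) (hz : z ∈ (extChartAt 𝓘(ℝ, E) a).target) :
    VField.inChart a ⁅X, Y⁆ z =
      fderiv ℝ (VField.inChart a Y) z (VField.inChart a X z) -
        fderiv ℝ (VField.inChart a X) z (VField.inChart a Y z) := by
  have hpull (W : VField E M) :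
      mpullback 𝓘(ℝ, E) 𝓘(ℝ, E) (extChartAt 𝓘(ℝ, E) a).symm (fun b => W b) =ᶠ[𝓝 z]
        VField.inChart (E := E) a W := by
    filter_upwards [(isOpen_extChartAt_target a).mem_nhds hz] with w hw
    exact W.mpullback_extChartAt_symm hw
  have hsymm : CMDiffAt 2 (extChartAt 𝓘(ℝ, E) a).symm z :=
    ((contMDiffOn_extChartAt_symm (n := ∞) a).contMDiffAt
      ((isOpen_extChartAt_target a).mem_nhds hz)).of_le ENat.LEInfty.out
  have hpull_lie := (⁅X, Y⁆.mpullback_extChartAt_symm hz).symm.trans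
    (mpullback_mlieBracket (X.mdiffAt _) (Y.mdiffAt _) hsymm (by simp))
  have hmodel := mlieBracketWithin_eq_lieBracketWithin (𝕜 := ℝ) (V := VField.inChart a X)
    (W := VField.inChart a Y) (s := univ)
  rw [lieBracketWithin_univ] at hmodel
  exact (hpull_lie.trans ((hpull X).mlieBracket_vectorField_eq (hpull Y))).trans congr($hmodel z)

theorem VField.inChart_eq_zero_iff (X : VField E M) (hz : z ∈ (extChartAt 𝓘(ℝ, E) a).target) :
    VField.inChart a X z = 0 ↔ X ((extChartAt 𝓘(ℝ, E) a).symm z) = 0 := by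
  rw [← X.mfderiv_extChartAt_symm_inChart hz]
  exact (map_eq_zero_iff _ (isInvertible_mfderiv_extChartAt_symm hz).injective).symm

theorem VField.isClosed_setOf_eq_zero (X : VField E M) : IsClosed {b | X b = 0} := by
  rw [← isOpen_compl_iff, isOpen_iff_mem_nhds]
  intro a ha
  have hcoord : VField.coord a X a ≠ 0 := (coord_self X a).trans_ne ha
  filter_upwards [(X.contMDiffAt_coord a).continuousAt.eventually_ne hcoord,
    chart_source_mem_nhds E a] with b hb hbs hXb
  exact hb ((coord_eq X a b hbs).trans ((congrArg _ hXb).trans (map_zero _)))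

theorem lie_apply_of_eq_zero (V : VField E M) (hX : X a = 0) :
    ⁅V, X⁆ a = X.coordDeriv a (V a) := by
  rw [bracket_coord, hX, map_zero, sub_zero]
  rfl

theorem exists_apply_eq [T2Space M] (a : M) (u : TangentSpace 𝓘(ℝ, E) a) :
    ∃ Y : VField E M, Y a = u := by
  obtain ⟨s, hs, hu⟩ := FiberBundle.exists_contMDiffOn_extend (k := ∞) 𝓘(ℝ, E) E u
  obtain ⟨χ, -, hχ⟩ := (SmoothBumpFunction.nhds_basis_tsupport (I := 𝓘(ℝ, E)) a).mem_iff.1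
    (interior_mem_nhds.2 hs)
  refine ⟨⟨(fun x => χ x) • FiberBundle.extend E u, ContMDiffOn.smul_section_of_tsupport
    χ.contMDiff.contMDiffOn isOpen_interior hχ (hu.mono interior_subset)⟩, ?_⟩
  change χ a • FiberBundle.extend E u a = u
  rw [χ.eq_one, one_smul, FiberBundle.extend_apply_self]

theorem exists_inChart_eq [T2Space M] (hz : z ∈ (extChartAt 𝓘(ℝ, E) a).target) (u : E) :
    ∃ Y : VField E M, VField.inChart a Y z = u := by
  obtain ⟨Y, hY⟩ := exists_apply_eq ((extChartAt 𝓘(ℝ, E) a).symm z)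
    (mfderiv 𝓘(ℝ, E) 𝓘(ℝ, E) (extChartAt 𝓘(ℝ, E) a).symm z u)
  exact ⟨Y, (isInvertible_mfderiv_extChartAt_symm hz).injective
    ((Y.mfderiv_extChartAt_symm_inChart hz).trans hY)⟩

end Chart

section KillingEquation

variable {E : Type*} [NormedAddCommGroup E] [NormedSpace ℝ E] [FiniteDimensional ℝ E]
  {M : Type*} [TopologicalSpace M] [ChartedSpace E M] [IsManifold 𝓘(ℝ, E) ∞ M]
  {g : LorentzMetric E M} {X Y Z : VField E M} {a : M} {z : E}

theorem LorentzMetric.inChart_apply (g : LorentzMetric E M) (Y Z : VField E M)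
    (hz : z ∈ (extChartAt 𝓘(ℝ, E) a).target) :
    g.inChart a z (VField.inChart a Y z) (VField.inChart a Z z) =
      g.toFun ((extChartAt 𝓘(ℝ, E) a).symm z) (Y ((extChartAt 𝓘(ℝ, E) a).symm z))
        (Z ((extChartAt 𝓘(ℝ, E) a).symm z)) :=
  (eval_eq Y Z (g.toSection a) (g.toSection ((extChartAt 𝓘(ℝ, E) a).symm z))
    (extChartAt_symm_mem_chart_source hz)).symm

theorem LorentzMetric.mvfderiv_apply_inChart (g : LorentzMetric E M) (V Y Z : VField E M)
    (hz : z ∈ (extChartAt 𝓘(ℝ, E) a).target) :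
    mvfderiv 𝓘(ℝ, E) (fun b => g.toFun b (Y b) (Z b)) ((extChartAt 𝓘(ℝ, E) a).symm z)
        (V ((extChartAt 𝓘(ℝ, E) a).symm z)) =
      fderiv ℝ (g.inChart a) z (VField.inChart a V z) (VField.inChart a Y z)
          (VField.inChart a Z z) +
        g.inChart a z (fderiv ℝ (VField.inChart a Y) z (VField.inChart a V z))
          (VField.inChart a Z z) +
        g.inChart a z (VField.inChart a Y z)
          (fderiv ℝ (VField.inChart a Z) z (VField.inChart a V z)) := by
  have hcoord : (fun b => g.toFun b (Y b) (Z b)) ∘ (extChartAt 𝓘(ℝ, E) a).symm =ᶠ[𝓝 z]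
      fun w => g.inChart a w (VField.inChart a Y w) (VField.inChart a Z w) := by
    filter_upwards [(isOpen_extChartAt_target a).mem_nhds hz] with w hw
    exact (g.inChart_apply Y Z hw).symm
  have hg := ((g.contDiffAt_inChart hz).differentiableAt (by simp)).hasFDerivAt
  have hY := ((Y.contDiffAt_inChart hz).differentiableAt (by simp)).hasFDerivAt
  have hZ := ((Z.contDiffAt_inChart hz).differentiableAt (by simp)).hasFDerivAt
  rw [mvfderiv_extChartAt_symm V hz ((g.contMDiff_apply Y Z _).mdifferentiableAt (by simp)),
    hcoord.fderiv_eq, ((hg.clm_apply hY).clm_apply hZ).fderiv]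
  simp only [add_apply, ContinuousLinearMap.comp_apply, ContinuousLinearMap.flip_apply]
  ring

theorem LorentzMetric.mvfderiv_apply_of_eq_zero (g : LorentzMetric E M) (V W : VField E M)
    (hY : Y a = 0) :
    mvfderiv 𝓘(ℝ, E) (fun b => g.toFun b (Y b) (W b)) a (V a) = g.toFun a (⁅V, Y⁆ a) (W a) := by
  have hz := mem_extChartAt_target (I := 𝓘(ℝ, E)) a
  have hY' : VField.inChart a Y (extChartAt 𝓘(ℝ, E) a a) = 0 :=
    (Y.inChart_eq_zero_iff hz).2 (by rwa [extChartAt_to_inv])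
  have hderiv := g.mvfderiv_apply_inChart V Y W hz
  have hlie := g.inChart_apply ⁅V, Y⁆ W hz
  rw [VField.inChart_lie V Y hz] at hlie
  simp only [hY', map_zero, zero_apply, zero_add, add_zero, sub_zero] at hderiv hlie
  rw [hlie, extChartAt_to_inv] at hderiv
  exact hderiv

variable [T2Space M]

theorem LorentzMetric.inChart_symm (g : LorentzMetric E M)
    (hz : z ∈ (extChartAt 𝓘(ℝ, E) a).target) (u v : E) :
    g.inChart a z u v = g.inChart a z v u := by
  obtain ⟨Y, rfl⟩ := exists_inChart_eq hz u
  obtain ⟨Z, rfl⟩ := exists_inChart_eq hz v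
  rw [g.inChart_apply Y Z hz, g.inChart_apply Z Y hz, (g.isLorentz _).1]

theorem LorentzMetric.inChart_nondegenerate (g : LorentzMetric E M)
    (hz : z ∈ (extChartAt 𝓘(ℝ, E) a).target) {u : E} (hu : ∀ v, g.inChart a z u v = 0) :
    u = 0 := by
  obtain ⟨Y, rfl⟩ := exists_inChart_eq hz u
  refine (Y.inChart_eq_zero_iff hz).2 ((g.isLorentz _).eq_zero_of_forall fun w => ?_)
  obtain ⟨Z, rfl⟩ := exists_apply_eq _ w
  rw [← g.inChart_apply Y Z hz, hu]

theorem IsKilling.flatKilling_inChart_eq_zero (hX : IsKilling g X)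
    (hz : z ∈ (extChartAt 𝓘(ℝ, E) a).target) (u v : E) :
    flatKilling (g.inChart a) (VField.inChart a X) u v z = 0 := by
  obtain ⟨Y, rfl⟩ := exists_inChart_eq hz u
  obtain ⟨Z, rfl⟩ := exists_inChart_eq hz v
  have hkilling := hX Y Z ((extChartAt 𝓘(ℝ, E) a).symm z)
  rw [g.mvfderiv_apply_inChart X Y Z hz, ← g.inChart_apply _ _ hz, ← g.inChart_apply _ _ hz,
    VField.inChart_lie X Y hz, VField.inChart_lie X Z hz] at hkilling
  simp only [map_sub, sub_apply] at hkilling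
  rw [flatKilling]
  linarith

theorem IsKilling.eventually_eq_zero (hX : IsKilling g X) (h0 : X a = 0)
    (h1 : ∀ V : VField E M, ⁅V, X⁆ a = 0) : ∀ᶠ b in 𝓝 a, X b = 0 := by
  have hz := mem_extChartAt_target (I := 𝓘(ℝ, E)) a
  have hchart := (isOpen_extChartAt_target (I := 𝓘(ℝ, E)) a).mem_nhds hz
  have hX0 : VField.inChart a X (extChartAt 𝓘(ℝ, E) a a) = 0 :=
    (X.inChart_eq_zero_iff hz).2 (by rwa [extChartAt_to_inv])
  have hX1 : fderiv ℝ (VField.inChart a X) (extChartAt 𝓘(ℝ, E) a a) = 0 := by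
    ext u
    obtain ⟨V, rfl⟩ := exists_inChart_eq hz u
    have hlie := V.inChart_lie X hz
    rw [hX0, map_zero, sub_zero,
      (⁅V, X⁆.inChart_eq_zero_iff hz).2 (by rw [extChartAt_to_inv, h1])] at hlie
    exact hlie.symm
  have hzero := eventually_eq_zero_of_flatKilling_eq_zero
    ((g.contDiffAt_inChart hz).of_le ENat.LEInfty.out)
    ((X.contDiffAt_inChart hz).of_le ENat.LEInfty.out) (fun _ => g.inChart_nondegenerate hz)
    (Filter.mem_of_superset hchart fun _ hw => g.inChart_symm hw)
    (Filter.mem_of_superset hchart fun _ hw => hX.flatKilling_inChart_eq_zero hw) hX0 hX1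
  filter_upwards [(continuousAt_extChartAt (I := 𝓘(ℝ, E)) a).eventually (hzero.and hchart),
    extChartAt_source_mem_nhds (I := 𝓘(ℝ, E)) a] with b hb hbs
  have hXb := (X.inChart_eq_zero_iff hb.2).1 hb.1
  rwa [(extChartAt 𝓘(ℝ, E) a).left_inv hbs] at hXb

theorem IsKilling.eq_zero [ConnectedSpace M] (hX : IsKilling g X) (h0 : X a = 0)
    (h1 : ∀ V : VField E M, ⁅V, X⁆ a = 0) : X = 0 := by
  let S : Set M := {b | X b = 0} ∩ ⋂ V : VField E M, {b | ⁅V, X⁆ b = 0}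
  have hclosed : IsClosed S := X.isClosed_setOf_eq_zero.inter
    (isClosed_iInter fun V : VField E M => ⁅V, X⁆.isClosed_setOf_eq_zero)
  have hopen : IsOpen S := by
    refine isOpen_iff_mem_nhds.2 fun b hb => ?_
    have hzero := hX.eventually_eq_zero hb.1 fun V => mem_iInter.1 hb.2 V
    filter_upwards [eventually_eventually_nhds.2 hzero] with c hc
    have hXc : (fun d => X d) =ᶠ[𝓝 c] fun d => (0 : VField E M) d := hc
    refine ⟨hc.self_of_nhds, mem_iInter.2 fun V => ?_⟩
    exact (Filter.EventuallyEq.rfl.mlieBracket_vectorField_eq hXc).trans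
      congr(($(lie_zero V) : VField E M) c)
  have huniv : S = univ := IsClopen.eq_univ ⟨hclosed, hopen⟩ ⟨a, h0, mem_iInter.2 fun V => h1 V⟩
  ext b
  exact (huniv ▸ mem_univ b : b ∈ S).1

instance finiteDimensional_killingAlgebra [ConnectedSpace M] (g : LorentzMetric E M) :
    FiniteDimensional ℝ (killingAlgebra g) := by
  obtain ⟨a⟩ := (inferInstance : Nonempty M)
  let B := Module.finBasis ℝ E
  choose V hV using fun i => exists_apply_eq (E := E) a (B i)
  let jet : killingAlgebra g →ₗ[ℝ] E × (Fin (Module.finrank ℝ E) → E) :=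
    (LinearMap.prod (VField.evalAt a)
      (LinearMap.pi fun i => VField.evalAt a ∘ₗ LieAlgebra.ad ℝ (VField E M) (V i))) ∘ₗ
        (killingAlgebra g).toSubmodule.subtype
  refine FiniteDimensional.of_injective jet ((injective_iff_map_eq_zero jet).2 fun X hX => ?_)
  have h0 : (X : VField E M) a = 0 := congrArg Prod.fst hX
  have hderiv : ((X : VField E M).coordDeriv a).toLinearMap = 0 := B.ext fun i => by
    have hlie : ⁅V i, (X : VField E M)⁆ a = 0 := congrFun (congrArg Prod.snd hX) i
    rwa [lie_apply_of_eq_zero _ h0, hV] at hlie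
  refine Subtype.ext (IsKilling.eq_zero X.2 h0 fun W => ?_)
  rw [lie_apply_of_eq_zero W h0]
  exact congr($hderiv (W a))

end KillingEquation

theorem IsLorentzForm.exists_eq_smul_of_null {V : Type*} [AddCommGroup V] [Module ℝ V]
    [TopologicalSpace V] {B : V →L[ℝ] V →L[ℝ] ℝ} (hB : IsLorentzForm B) {n w : V} (hn : n ≠ 0)
    (hnn : B n n = 0) (hww : B w w = 0) (hnw : B n w = 0) : ∃ c : ℝ, w = c • n := by
  obtain ⟨hsymm, t, -, hpos⟩ := hB
  have htn : B t n ≠ 0 := fun h => (hpos n h hn).ne' hnn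
  refine ⟨B t w / B t n, ?_⟩
  by_contra hne
  refine (hpos (w - (B t w / B t n) • n) ?_ (sub_ne_zero.2 hne)).ne' ?_
  · rw [map_sub, map_smul, smul_eq_mul, div_mul_cancel₀ _ htn, sub_self]
  · simp [hnn, hww, hnw, hsymm w n]

theorem ker_eq_of_finrank_add_one {k V : Type*} [Field k] [AddCommGroup V] [Module k V]
    {T : Submodule k V} (hT : Module.finrank k T + 1 = Module.finrank k V) {β : Module.Dual k V}
    (hβ : β ≠ 0) (hTβ : T ≤ β.ker) : β.ker = T := by
  have : FiniteDimensional k V := FiniteDimensional.of_finrank_pos (hT ▸ Nat.succ_pos _)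
  have hker := Module.Dual.finrank_ker_add_one_of_ne_zero hβ
  exact (Submodule.eq_of_le_of_finrank_eq hTβ (by lia)).symm

theorem exists_eq_smul_of_ker_le_ker {k V : Type*} [Field k] [AddCommGroup V] [Module k V]
    {α β : Module.Dual k V} (h : β.ker ≤ α.ker) : ∃ c : k, c • β = α := by
  have hspan := mem_span_of_iInf_ker_le_ker (L := fun _ : Unit => β) ((iInf_const).trans_le h)
  rwa [range_const, Submodule.mem_span_singleton] at hspan

section SurfaceGravity

variable {E : Type*} [NormedAddCommGroup E] [NormedSpace ℝ E] [FiniteDimensional ℝ E]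
  {M : Type*} [TopologicalSpace M] [ChartedSpace E M] [IsManifold 𝓘(ℝ, E) ∞ M]
  {g : LorentzMetric E M} {K X Y : VField E M} {a : M}

theorem LorentzMetric.mdifferentiableAt_apply (g : LorentzMetric E M) (Y Z : VField E M) (a : M) :
    MDiffAt (fun b => g.toFun b (Y b) (Z b)) a :=
  (g.contMDiff_apply Y Z a).mdifferentiableAt (by simp)

theorem IsKilling.skew_of_eq_zero (hX : IsKilling g X) (h0 : X a = 0) (V W : VField E M) :
    g.toFun a (⁅V, X⁆ a) (W a) + g.toFun a (V a) (⁅W, X⁆ a) = 0 := by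
  have hkilling := hX V W a
  have hneg (U : VField E M) : ⁅X, U⁆ a = -⁅U, X⁆ a := congr(($(lie_skew X U) : VField E M) a).symm
  rw [h0, map_zero, hneg, hneg, map_neg, map_neg, neg_apply] at hkilling
  linarith

theorem lie_apply_of_eq_smul {x y : ℝ} (hX : X a = x • K a) (hY : Y a = y • K a) :
    ⁅X, Y⁆ a = x • ⁅K, Y⁆ a - y • ⁅K, X⁆ a := by
  have hX0 : (X - x • K) a = 0 := sub_eq_zero.2 hX
  have hY0 : (Y - y • K) a = 0 := sub_eq_zero.2 hY
  have hzero : ⁅X - x • K, Y - y • K⁆ a = 0 :=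
    (lie_apply_of_eq_zero _ hY0).trans ((congrArg _ hX0).trans (map_zero _))
  have hlie : ⁅X - x • K, Y - y • K⁆ = ⁅X, Y⁆ - (x • ⁅K, Y⁆ - y • ⁅K, X⁆) := by
    rw [sub_lie, lie_sub, lie_sub, smul_lie, smul_lie, lie_smul, lie_smul, lie_self, ← lie_skew X K]
    module
  rw [hlie] at hzero
  exact sub_eq_zero.1 hzero

theorem lie_lie_apply_eq_smul {x y x' y' κ : ℝ} (hX : X a = x • K a) (hY : Y a = y • K a)
    (hKX : ⁅K, X⁆ a = x' • K a) (hKY : ⁅K, Y⁆ a = y' • K a)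
    (hKKX : ⁅K, ⁅K, X⁆⁆ a = κ • ⁅K, X⁆ a) (hKKY : ⁅K, ⁅K, Y⁆⁆ a = κ • ⁅K, Y⁆ a) :
    ⁅K, ⁅X, Y⁆⁆ a = κ • ⁅X, Y⁆ a := by
  have hleibniz : ⁅K, ⁅X, Y⁆⁆ a = ⁅⁅K, X⁆, Y⁆ a + ⁅X, ⁅K, Y⁆⁆ a :=
    congr(($(leibniz_lie K X Y) : VField E M) a)
  rw [hleibniz, lie_apply_of_eq_smul hKX hY, lie_apply_of_eq_smul hX hKY,
    lie_apply_of_eq_smul hX hY, hKKX, hKKY, hKX, hKY]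
  module

theorem IsKilling.mvfderiv_apply_self (hY : IsKilling g Y) (K : VField E M) (b : M) :
    mvfderiv 𝓘(ℝ, E) (fun c => g.toFun c (K c) (K c)) b (Y b) =
      -2 * g.toFun b (⁅K, Y⁆ b) (K b) := by
  have hneg : ⁅Y, K⁆ b = -⁅K, Y⁆ b := congr(($(lie_skew Y K) : VField E M) b).symm
  rw [hY K K b, hneg, (g.isLorentz b).1 (K b), map_neg, neg_apply]
  ring

theorem IsKilling.mvfderiv_mvfderiv_of_eq_zero {κ : ℝ} (hY : IsKilling g Y) (h0 : Y a = 0)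
    (hκ : ∀ v, mvfderiv 𝓘(ℝ, E) (fun b => g.toFun b (K b) (K b)) a v =
      2 * κ * g.toFun a (K a) v) (V : VField E M) :
    mvfderiv 𝓘(ℝ, E) (fun c => mvfderiv 𝓘(ℝ, E) (fun b => g.toFun b (K b) (K b)) c (Y c)) a (V a) =
      -(2 * κ * g.toFun a (V a) (⁅K, Y⁆ a)) := by
  have hbracket := VField.deriv_bracket V Y (g.contMDiff_apply K K) a
  have hskew := hY.skew_of_eq_zero h0 V K
  rw [h0, map_zero, sub_zero, hκ, (g.isLorentz a).1] at hbracket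
  rw [← hbracket]
  linear_combination 2 * κ * hskew

/- With `φ = g(K, K)` and `Z = [K, Y] - zK`, the Killing equation reads `Yφ = -2g(Z, K) - 2zφ`. At
the common zero `a` of `Y` and `Z`, the derivative of this equation along `V` involves only `dφ`,
which is known, and `g([V, Z], K) = -g(V, [K, Z]) = -g(V, [K, [K, Y]])`. -/
theorem IsKilling.lie_lie_eq_smul_of_eq_zero [T2Space M] {z κ : ℝ} (hK : IsKilling g K)
    (hY : IsKilling g Y) (h0 : Y a = 0) (hKY : ⁅K, Y⁆ a = z • K a)
    (hκ : ∀ v, mvfderiv 𝓘(ℝ, E) (fun b => g.toFun b (K b) (K b)) a v =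
      2 * κ * g.toFun a (K a) v) :
    ⁅K, ⁅K, Y⁆⁆ a = κ • ⁅K, Y⁆ a := by
  let Z : VField E M := ⁅K, Y⁆ - z • K
  have hZ : IsKilling g Z := (killingAlgebra g).sub_mem ((killingAlgebra g).lie_mem hK hY)
    ((killingAlgebra g).smul_mem z hK)
  have hZ0 : Z a = 0 := sub_eq_zero.2 hKY
  have hKZ : ⁅K, Z⁆ = ⁅K, ⁅K, Y⁆⁆ := by rw [lie_sub, lie_smul, lie_self, smul_zero, sub_zero]
  let φ (b : M) : ℝ := g.toFun b (K b) (K b)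
  let ζ (b : M) : ℝ := g.toFun b (Z b) (K b)
  have hYφ : (fun b => mvfderiv 𝓘(ℝ, E) φ b (Y b)) = (-2 : ℝ) • ζ + (-(2 * z)) • φ := by
    funext b
    have hZb : Z b = ⁅K, Y⁆ b - z • K b := rfl
    refine (hY.mvfderiv_apply_self K b).trans ?_
    change _ = -2 * g.toFun b (Z b) (K b) + -(2 * z) * g.toFun b (K b) (K b)
    rw [hZb, map_sub, map_smul, sub_apply, smul_apply, smul_eq_mul]
    ring
  refine sub_eq_zero.1 ((g.isLorentz a).eq_zero_of_forall fun v => ?_)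
  obtain ⟨V, rfl⟩ := exists_apply_eq a v
  have hφ : MDiffAt φ a := g.mdifferentiableAt_apply K K a
  have hζ : MDiffAt ζ a := g.mdifferentiableAt_apply Z K a
  have hderiv : mvfderiv 𝓘(ℝ, E) (fun b => mvfderiv 𝓘(ℝ, E) φ b (Y b)) a (V a) =
      -2 * mvfderiv 𝓘(ℝ, E) ζ a (V a) + -(2 * z) * mvfderiv 𝓘(ℝ, E) φ a (V a) := by
    rw [hYφ]
    exact congr($(((hζ.hasMFDerivAt.const_smul (-2)).add
      (hφ.hasMFDerivAt.const_smul (-(2 * z)))).mfderiv) (V a))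
  have hVζ : mvfderiv 𝓘(ℝ, E) ζ a (V a) = g.toFun a (⁅V, Z⁆ a) (K a) :=
    g.mvfderiv_apply_of_eq_zero V K hZ0
  have hskew := hZ.skew_of_eq_zero hZ0 V K
  have hgKY : g.toFun a (V a) (⁅K, Y⁆ a) = z * g.toFun a (K a) (V a) := by
    rw [hKY, map_smul, smul_eq_mul, (g.isLorentz a).1]
  rw [hKZ] at hskew
  rw [hY.mvfderiv_mvfderiv_of_eq_zero h0 hκ V, hVζ, hκ, hgKY] at hderiv
  rw [map_sub, map_smul, sub_apply, smul_apply, smul_eq_mul, (g.isLorentz a).1,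
    (g.isLorentz a).1 (⁅K, Y⁆ a), hgKY]
  linear_combination hskew - hderiv / 2

theorem IsKilling.lie_lie_eq_smul [T2Space M] {x z κ : ℝ} (hK : IsKilling g K)
    (hX : IsKilling g X) (hXK : X a = x • K a) (hKX : ⁅K, X⁆ a = z • K a)
    (hκ : ∀ v, mvfderiv 𝓘(ℝ, E) (fun b => g.toFun b (K b) (K b)) a v =
      2 * κ * g.toFun a (K a) v) :
    ⁅K, ⁅K, X⁆⁆ a = κ • ⁅K, X⁆ a := by
  have hY : IsKilling g (X - x • K) :=
    (killingAlgebra g).sub_mem hX ((killingAlgebra g).smul_mem x hK)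
  have hKY : ⁅K, X - x • K⁆ = ⁅K, X⁆ := by rw [lie_sub, lie_smul, lie_self, smul_zero, sub_zero]
  have h := hK.lie_lie_eq_smul_of_eq_zero hY (sub_eq_zero.2 hXK) (by rwa [hKY]) hκ
  rwa [hKY] at h

end SurfaceGravity

theorem coe_eq_sum_repr {E : Type*} [NormedAddCommGroup E] [NormedSpace ℝ E]
    [FiniteDimensional ℝ E] {M : Type*} [TopologicalSpace M] [ChartedSpace E M]
    [IsManifold 𝓘(ℝ, E) ∞ M] {𝔥 : LieSubalgebra ℝ (VField E M)} {J : LieIdeal ℝ 𝔥}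
    {n : Type*} [Fintype n] (b : Module.Basis n ℝ J) {K : n → VField E M}
    (hK : ∀ i, K i = ((b i : 𝔥) : VField E M)) (Y : J) :
    ((Y : 𝔥) : VField E M) = ∑ i, b.repr Y i • K i := by
  have hsum := congrArg (𝔥.toSubmodule.subtype ∘ₗ J.toSubmodule.subtype) (b.sum_repr Y).symm
  simp only [map_sum, map_smul] at hsum
  rw [funext hK]
  exact hsum

section Horizon

variable {E : Type*} [NormedAddCommGroup E] [NormedSpace ℝ E]
  {M : Type*} [TopologicalSpace M] [ChartedSpace E M]
  {E' : Type*} [NormedAddCommGroup E'] [NormedSpace ℝ E']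
  {N : Type*} [TopologicalSpace N] [ChartedSpace E' N]
  {ι : N → M} {p : N}

theorem IsHypersurface.finrank_tangent (h : IsHypersurface (E := E) (E' := E') ι) (p : N) :
    Module.finrank ℝ (hypersurfaceTangent (E := E) (E' := E') ι p) + 1 =
      Module.finrank ℝ (TangentSpace 𝓘(ℝ, E) (ι p)) :=
  (congrArg (· + 1) (LinearMap.finrank_range_of_inj (M := E') (N := E)
    (h.injective_mfderiv p))).trans h.finrank_eq

theorem IsHypersurface.mdifferentiableAt (h : IsHypersurface (E := E) (E' := E') ι) (p : N) :
    MDifferentiableAt 𝓘(ℝ, E') 𝓘(ℝ, E) ι p :=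
  (h.contMDiff p).mdifferentiableAt (by simp)

theorem mvfderiv_eq_zero_of_mem_hypersurfaceTangent {F : Type*} [NormedAddCommGroup F]
    [NormedSpace ℝ F] {f : M → F} (hι : MDifferentiableAt 𝓘(ℝ, E') 𝓘(ℝ, E) ι p)
    (hf : MDiffAt f (ι p)) (h0 : ∀ q, f (ι q) = 0) {v : TangentSpace 𝓘(ℝ, E) (ι p)}
    (hv : v ∈ hypersurfaceTangent (E := E) (E' := E') ι p) : mvfderiv 𝓘(ℝ, E) f (ι p) v = 0 := by
  obtain ⟨w, rfl⟩ := hv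
  have hcomp := (hf.hasMFDerivAt.comp p hι.hasMFDerivAt).mfderiv
  rw [show f ∘ ι = fun _ => 0 from funext h0, mfderiv_const] at hcomp
  exact congr($hcomp w).symm

variable [FiniteDimensional ℝ E] [IsManifold 𝓘(ℝ, E) ∞ M] {g : LorentzMetric E M}
  {K X Z : VField E M}

theorem IsKilling.eq_zero_of_forall_hypersurface [T2Space M] [ConnectedSpace M] [Nonempty N]
    (hX : IsKilling g X) (h : IsHypersurface (E := E) (E' := E') ι) (h0 : ∀ p, X (ι p) = 0) :
    X = 0 := by
  obtain ⟨p⟩ := ‹Nonempty N›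
  let T := hypersurfaceTangent (E := E) (E' := E') ι p
  have htangent (V : VField E M) (hV : V (ι p) ∈ T) : ⁅V, X⁆ (ι p) = 0 := by
    refine (g.isLorentz _).eq_zero_of_forall fun w => ?_
    obtain ⟨W, rfl⟩ := exists_apply_eq (ι p) w
    rw [← g.mvfderiv_apply_of_eq_zero V W (h0 p)]
    exact mvfderiv_eq_zero_of_mem_hypersurfaceTangent (h.mdifferentiableAt p)
      (g.mdifferentiableAt_apply X W _) (fun q => by rw [h0, map_zero, zero_apply]) hV
  refine hX.eq_zero (h0 p) fun V => ?_
  by_contra hne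
  let β : Module.Dual ℝ (TangentSpace 𝓘(ℝ, E) (ι p)) := (g.toFun (ι p) (⁅V, X⁆ (ι p))).toLinearMap
  have hβ : β ≠ 0 := fun hβ => hne ((g.isLorentz _).eq_zero_of_forall fun w => congr($hβ w))
  have hTβ : T ≤ β.ker := fun t ht => by
    obtain ⟨W, rfl⟩ := exists_apply_eq (ι p) t
    have hskew := hX.skew_of_eq_zero (h0 p) V W
    rwa [htangent W ht, map_zero, add_zero] at hskew
  have hVβ : V (ι p) ∈ β.ker := by
    have hskew := hX.skew_of_eq_zero (h0 p) V V
    rw [(g.isLorentz _).1 (V (ι p)), ← two_mul] at hskew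
    exact (mul_eq_zero.1 hskew).resolve_left two_ne_zero
  rw [ker_eq_of_finrank_add_one (h.finrank_tangent p) hβ hTβ] at hVβ
  exact hne (htangent V hVβ)

/-- `K` is a Killing vector field generating the null hypersurface `ι`: along `ι` it is null,
nowhere zero and orthogonal to the hypersurface. -/
structure IsNullGenerator (g : LorentzMetric E M) (ι : N → M) (K : VField E M) : Prop where
  isHypersurface : IsHypersurface (E := E) (E' := E') ι
  isKilling : IsKilling g K
  null : ∀ p, g.toFun (ι p) (K (ι p)) (K (ι p)) = 0
  ne_zero : ∀ p, K (ι p) ≠ 0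
  orthogonal : ∀ p, ∀ v ∈ hypersurfaceTangent (E := E) (E' := E') ι p,
    g.toFun (ι p) (K (ι p)) v = 0

theorem IsKillingHorizon.exists_isNullGenerator (h : IsKillingHorizon (E' := E') g ι) :
    ∃ K, IsNullGenerator (E' := E') g ι K := by
  obtain ⟨K, hK, hKp⟩ := h.exists_generator
  refine ⟨K, h.isHypersurface, hK, fun p => (hKp p).1, fun p => (hKp p).2.2, fun p v hv => ?_⟩
  obtain ⟨n, hnT, hn, horth⟩ := h.isNull p
  obtain ⟨hKnull, hKT, -⟩ := hKp p
  obtain ⟨c, hc⟩ := (g.isLorentz _).exists_eq_smul_of_null hn (horth n hnT) hKnull (horth _ hKT)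
  rw [hc, map_smul, smul_apply, horth v hv, smul_zero]

namespace IsNullGenerator

theorem exists_eq_smul (h : IsNullGenerator (E' := E') g ι K)
    {v : TangentSpace 𝓘(ℝ, E) (ι p)} (hv : v ∈ hypersurfaceTangent (E := E) (E' := E') ι p)
    (hvv : g.toFun (ι p) v v = 0) : ∃ c : ℝ, v = c • K (ι p) :=
  (g.isLorentz _).exists_eq_smul_of_null (h.ne_zero p) (h.null p) hvv (h.orthogonal p v hv)

theorem orthogonal_of_exists_eq_smul (h : IsNullGenerator (E' := E') g ι K)
    {v w : TangentSpace 𝓘(ℝ, E) (ι p)} (hv : ∃ c : ℝ, v = c • K (ι p))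
    (hw : w ∈ hypersurfaceTangent (E := E) (E' := E') ι p) : g.toFun (ι p) v w = 0 := by
  obtain ⟨c, rfl⟩ := hv
  rw [map_smul, smul_apply, h.orthogonal p w hw, smul_zero]

theorem exists_mvfderiv_eq (h : IsNullGenerator (E' := E') g ι K) (p : N) :
    ∃ κ : ℝ, ∀ v, mvfderiv 𝓘(ℝ, E) (fun b => g.toFun b (K b) (K b)) (ι p) v =
      2 * κ * g.toFun (ι p) (K (ι p)) v := by
  let α : Module.Dual ℝ (TangentSpace 𝓘(ℝ, E) (ι p)) :=
    (mvfderiv 𝓘(ℝ, E) (fun b => g.toFun b (K b) (K b)) (ι p)).toLinearMap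
  let β : Module.Dual ℝ (TangentSpace 𝓘(ℝ, E) (ι p)) := (g.toFun (ι p) (K (ι p))).toLinearMap
  have hβ : β ≠ 0 := fun hβ =>
    h.ne_zero p ((g.isLorentz _).eq_zero_of_forall fun w => congr($hβ w))
  have hker : β.ker ≤ α.ker := by
    rw [ker_eq_of_finrank_add_one (h.isHypersurface.finrank_tangent p) hβ (h.orthogonal p)]
    exact fun v hv => mvfderiv_eq_zero_of_mem_hypersurfaceTangent
      (h.isHypersurface.mdifferentiableAt p) (g.mdifferentiableAt_apply K K _) h.null hv
  obtain ⟨c, hc⟩ := exists_eq_smul_of_ker_le_ker hker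
  refine ⟨c / 2, fun v => ?_⟩
  rw [mul_div_cancel₀ c two_ne_zero]
  exact congr($hc v).symm

theorem exists_lie_eq_smul (h : IsNullGenerator (E' := E') g ι K)
    (hinv : IsKillingInvariant (E' := E') g ι) (hZ : IsKilling g Z) (hX : IsKilling g X)
    (hXK : ∀ p, ∃ c : ℝ, X (ι p) = c • K (ι p)) (p : N) :
    ∃ c : ℝ, ⁅Z, X⁆ (ι p) = c • K (ι p) := by
  have hZX := (killingAlgebra g).lie_mem hZ hX
  have hZZX := (killingAlgebra g).lie_mem hZ hZX
  have horth (q : N) : g.toFun (ι q) (⁅Z, X⁆ (ι q)) (X (ι q)) = 0 := by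
    rw [(g.isLorentz _).1]
    exact h.orthogonal_of_exists_eq_smul (hXK q) (hinv _ hZX q)
  have hderiv := hZ ⁅Z, X⁆ X (ι p)
  rw [mvfderiv_eq_zero_of_mem_hypersurfaceTangent (h.isHypersurface.mdifferentiableAt p)
    (g.mdifferentiableAt_apply ⁅Z, X⁆ X _) horth (hinv Z hZ p), (g.isLorentz _).1 _ (X (ι p)),
    h.orthogonal_of_exists_eq_smul (hXK p) (hinv _ hZZX p), zero_add] at hderiv
  exact h.exists_eq_smul (hinv _ hZX p) hderiv.symm

/-- The ideal of the Killing vector fields that are multiples of the null generator `K` at each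
point of the hypersurface. -/
def nullIdeal (h : IsNullGenerator (E' := E') g ι K) (hinv : IsKillingInvariant (E' := E') g ι) :
    LieIdeal ℝ (killingAlgebra g) where
  carrier := {X | ∀ p, ∃ c : ℝ, (X : VField E M) (ι p) = c • K (ι p)}
  zero_mem' _ := ⟨0, (zero_smul ℝ _).symm⟩
  add_mem' hX hY p :=
    have ⟨c, hc⟩ := hX p
    have ⟨d, hd⟩ := hY p
    ⟨c + d, congr($hc + $hd).trans (add_smul c d _).symm⟩
  smul_mem' t _ hX p :=
    have ⟨c, hc⟩ := hX p
    ⟨t * c, congr(t • $hc).trans (mul_smul t c _).symm⟩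
  lie_mem {Z X} hX := h.exists_lie_eq_smul hinv Z.2 X.2 hX

variable {h : IsNullGenerator (E' := E') g ι K} {hinv : IsKillingInvariant (E' := E') g ι}

theorem mem_nullIdeal {X : killingAlgebra g} :
    X ∈ nullIdeal h hinv ↔ ∀ p, ∃ c : ℝ, (X : VField E M) (ι p) = c • K (ι p) :=
  Iff.rfl

theorem exists_lie_lie_eq_smul [T2Space M] (h : IsNullGenerator (E' := E') g ι K)
    (hinv : IsKillingInvariant (E' := E') g ι) (p : N) :
    ∃ κ : ℝ, ∀ X ∈ nullIdeal h hinv,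
      ⁅K, ⁅K, (X : VField E M)⁆⁆ (ι p) = κ • ⁅K, (X : VField E M)⁆ (ι p) := by
  obtain ⟨κ, hκ⟩ := h.exists_mvfderiv_eq p
  refine ⟨κ, fun X hX => ?_⟩
  rw [mem_nullIdeal] at hX
  obtain ⟨x, hx⟩ := hX p
  obtain ⟨z, hz⟩ := h.exists_lie_eq_smul hinv h.isKilling X.2 hX p
  exact h.isKilling.lie_lie_eq_smul X.2 hx hz hκ

theorem lie_eq_smul_of_mem_lie_nullIdeal {κ : ℝ}
    (hκ : ∀ X ∈ nullIdeal h hinv,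
      ⁅K, ⁅K, (X : VField E M)⁆⁆ (ι p) = κ • ⁅K, (X : VField E M)⁆ (ι p))
    {W : killingAlgebra g} (hW : W ∈ ⁅nullIdeal h hinv, nullIdeal h hinv⁆) :
    ⁅K, (W : VField E M)⁆ (ι p) = κ • (W : VField E M) (ι p) := by
  let ev : killingAlgebra g →ₗ[ℝ] TangentSpace 𝓘(ℝ, E) (ι p) :=
    VField.evalAt (ι p) ∘ₗ (killingAlgebra g).toSubmodule.subtype
  let S := (ev ∘ₗ LieAlgebra.ad ℝ (killingAlgebra g) ⟨K, h.isKilling⟩).eqLocus (κ • ev)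
  have hle :
      (⁅nullIdeal h hinv, nullIdeal h hinv⁆ : LieIdeal ℝ (killingAlgebra g)).toSubmodule ≤ S := by
    rw [LieSubmodule.lieIdeal_oper_eq_linear_span', Submodule.span_le]
    rintro _ ⟨X, hX, Y, hY, rfl⟩
    have hXK := mem_nullIdeal.1 hX
    have hYK := mem_nullIdeal.1 hY
    obtain ⟨x, hx⟩ := hXK p
    obtain ⟨y, hy⟩ := hYK p
    obtain ⟨x', hx'⟩ := h.exists_lie_eq_smul hinv h.isKilling X.2 hXK p
    obtain ⟨y', hy'⟩ := h.exists_lie_eq_smul hinv h.isKilling Y.2 hYK p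
    exact lie_lie_apply_eq_smul hx hy hx' hy' (hκ X hX) (hκ Y hY)
  exact hle hW

theorem derivedSeriesOfIdeal_nullIdeal_eq_bot [T2Space M] [ConnectedSpace M] [Nonempty N] :
    derivedSeriesOfIdeal ℝ (killingAlgebra g) 2 (nullIdeal h hinv) = ⊥ := by
  choose κ hκ using h.exists_lie_lie_eq_smul hinv
  have hle : ⁅nullIdeal h hinv, nullIdeal h hinv⁆ ≤ nullIdeal h hinv := LieSubmodule.lie_le_left ..
  rw [derivedSeriesOfIdeal_succ, derivedSeriesOfIdeal_succ, derivedSeriesOfIdeal_zero,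
    LieSubmodule.lie_eq_bot_iff]
  intro X hX Y hY
  refine Subtype.ext (IsKilling.eq_zero_of_forall_hypersurface ⁅X, Y⁆.2 h.isHypersurface
    fun p => ?_)
  obtain ⟨x, hx⟩ := mem_nullIdeal.1 (hle hX) p
  obtain ⟨y, hy⟩ := mem_nullIdeal.1 (hle hY) p
  refine (lie_apply_of_eq_smul hx hy).trans ?_
  rw [lie_eq_smul_of_mem_lie_nullIdeal (hκ p) hX, lie_eq_smul_of_mem_lie_nullIdeal (hκ p) hY,
    hx, hy]
  module

theorem nullIdeal_ne_bot [Nonempty N] : nullIdeal h hinv ≠ ⊥ := by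
  obtain ⟨p⟩ := ‹Nonempty N›
  intro hbot
  have hmem : ⟨K, h.isKilling⟩ ∈ nullIdeal h hinv :=
    mem_nullIdeal.2 fun q => ⟨1, (one_smul ℝ _).symm⟩
  rw [hbot, LieSubmodule.mem_bot] at hmem
  exact h.ne_zero p congr(($hmem : VField E M) (ι p))

theorem exists_ne_zero_mem_radicalAbelianIdeal [T2Space M] [ConnectedSpace M] [Nonempty N]
    (h : IsNullGenerator (E' := E') g ι K) (hinv : IsKillingInvariant (E' := E') g ι) :
    ∃ Y ∈ radicalAbelianIdeal (killingAlgebra g), Y ≠ 0 ∧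
      ∀ p, ∃ c : ℝ, (Y : VField E M) (ι p) = c • K (ι p) := by
  have hrad := le_radical_of_derivedSeriesOfIdeal_eq_bot
    (derivedSeriesOfIdeal_nullIdeal_eq_bot (h := h) (hinv := hinv))
  obtain ⟨Y, hYJ, hY0, hY⟩ :=
    KillingHorizons.exists_ne_zero_mem_radicalAbelianIdeal hrad nullIdeal_ne_bot
  exact ⟨Y, hY, hY0, mem_nullIdeal.1 hYJ⟩

end IsNullGenerator

theorem metricWedgeNormSq_eq_zero [T2Space M] [ConnectedSpace M] {r : ℕ}
    (b : Module.Basis (Fin r) ℝ (radicalAbelianIdeal (killingAlgebra g)))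
    {K : Fin r → VField E M} (hK : ∀ i, K i = ((b i : killingAlgebra g) : VField E M))
    (hH : IsKillingHorizon (E' := E') g ι) (hinv : IsKillingInvariant (E' := E') g ι) (p : N) :
    metricWedgeNormSq g K (ι p) = 0 := by
  have : Nonempty N := ⟨p⟩
  obtain ⟨K₀, h⟩ := hH.exists_isNullGenerator
  obtain ⟨Y, hY, hY0, hYK₀⟩ := h.exists_ne_zero_mem_radicalAbelianIdeal hinv
  have hrepr : ⇑(b.repr ⟨Y, hY⟩) ≠ 0 := fun h0 =>
    hY0 congr(($(b.repr.map_eq_zero_iff.1 (DFunLike.ext' h0)) : killingAlgebra g))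
  refine metricWedgeNormSq_eq_zero_of_sum_smul hrepr fun i => ?_
  rw [← VField.sum_smul_apply, ← coe_eq_sum_repr b hK]
  exact h.orthogonal_of_exists_eq_smul (hYK₀ p) (hinv _ (by rw [hK]; exact (b i).1.2) p)

end Horizon

section Normalizer

variable {E : Type*} [NormedAddCommGroup E] [NormedSpace ℝ E] [FiniteDimensional ℝ E]
  {M : Type*} [TopologicalSpace M] [ChartedSpace E M] [IsManifold 𝓘(ℝ, E) ∞ M]
  {g : LorentzMetric E M}

/-- The derivation `K ↦ [X, K]` of the Killing algebra defined by a vector field `X` that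
normalizes it. -/
def normalizerDerivation (X : VField E M)
    (hX : ∀ K ∈ killingAlgebra g, ⁅X, K⁆ ∈ killingAlgebra g) :
    LieDerivation ℝ (killingAlgebra g) (killingAlgebra g) where
  toFun K := ⟨⁅X, (K : VField E M)⁆, hX K K.2⟩
  map_add' K L := Subtype.ext (lie_add X (K : VField E M) (L : VField E M))
  map_smul' c K := Subtype.ext (lie_smul c X (K : VField E M))
  leibniz' K L := Subtype.ext <| (leibniz_lie X (K : VField E M) (L : VField E M)).trans <| by
    rw [← lie_skew, neg_add_eq_sub]
    rfl

variable [T2Space M] [ConnectedSpace M] {𝔤 : LieSubalgebra ℝ (VField E M)}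
  (hideal : ∀ X ∈ 𝔤, ∀ K ∈ killingAlgebra g, ⁅X, K⁆ ∈ killingAlgebra g)

/-- The adjoint action of `𝔤` on `𝔞(𝔯)`, for a Lie algebra `𝔤` of vector fields that normalizes the
Killing algebra. -/
def radicalAction : 𝔤 →ₗ[ℝ] Module.End ℝ (radicalAbelianIdeal (killingAlgebra g)) where
  toFun X := (normalizerDerivation X.1 (hideal X X.2)).toLinearMap.restrict fun _ hK =>
    derivation_mem_radicalAbelianIdeal _ hK
  map_add' X Y := LinearMap.ext fun K => Subtype.ext <| Subtype.ext <|
    add_lie (X : VField E M) (Y : VField E M) (K : VField E M)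
  map_smul' c X := LinearMap.ext fun K => Subtype.ext <| Subtype.ext <|
    smul_lie c (X : VField E M) (K : VField E M)

/-- The weight `λ ∈ 𝔤*` by which `𝔤` acts on the top exterior power of `𝔞(𝔯)`. -/
def radicalWeight : 𝔤 →ₗ[ℝ] ℝ :=
  LinearMap.trace ℝ _ ∘ₗ radicalAction hideal

variable {r : ℕ} {b : Module.Basis (Fin r) ℝ (radicalAbelianIdeal (killingAlgebra g))}
  {K : Fin r → VField E M}

theorem lie_eq_sum_toMatrix_smul (hK : ∀ i, K i = ((b i : killingAlgebra g) : VField E M))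
    (X : 𝔤) (i : Fin r) :
    ⁅(X : VField E M), K i⁆ =
      ∑ k, (LinearMap.toMatrix b b (radicalAction hideal X)).transpose i k • K k := by
  simp only [Matrix.transpose_apply, LinearMap.toMatrix_apply]
  rw [← coe_eq_sum_repr b hK, hK]
  rfl

theorem radicalWeight_eq_trace (b : Module.Basis (Fin r) ℝ (radicalAbelianIdeal (killingAlgebra g)))
    (X : 𝔤) : radicalWeight hideal X =
      (LinearMap.toMatrix b b (radicalAction hideal X)).transpose.trace := by
  rw [Matrix.trace_transpose]
  exact LinearMap.trace_eq_matrix_trace ℝ b _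

end Normalizer

end KillingHorizons

end

theorem theorem2_general
    {E : Type*} [NormedAddCommGroup E] [NormedSpace ℝ E] [FiniteDimensional ℝ E]
    {M : Type*} [TopologicalSpace M] [ChartedSpace E M] [IsManifold 𝓘(ℝ, E) ∞ M]
    [T2Space M] [ConnectedSpace M] (g : LorentzMetric E M) (𝔤 : LieSubalgebra ℝ (VField E M))
    (hideal : ∀ X ∈ 𝔤, ∀ K ∈ killingAlgebra g, ⁅X, K⁆ ∈ killingAlgebra g)
    {r : ℕ} (b : Module.Basis (Fin r) ℝ (radicalAbelianIdeal (killingAlgebra g)))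
    (K : Fin r → VField E M) (hK : ∀ i, K i = ((b i : killingAlgebra g) : VField E M)) :
    (∀ i j, ⁅K i, K j⁆ = 0) ∧
    (∀ X ∈ 𝔤, ∀ i, ⁅X, K i⁆ ∈ Submodule.span ℝ (Set.range K)) ∧
    (∀ (E' : Type*) [NormedAddCommGroup E'] [NormedSpace ℝ E']
      (N : Type*) [TopologicalSpace N] [ChartedSpace E' N]
      (ι : N → M), IsKillingHorizon (E' := E') g ι → IsKillingInvariant (E' := E') g ι →
      ∀ p, metricWedgeNormSq g K (ι p) = 0) ∧
    (∃ wt : 𝔤 →ₗ[ℝ] ℝ,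
      (∀ (X : 𝔤) (a : M), lieWedgeAt (X : VField E M) K a = wt X • wedgeAt K a) ∧
      IsRelativeInvariantOn 𝔤 Set.univ (wedgeInvariant K) ((2 : ℝ) • wt)) ∧
    (∀ a, metricWedgeNormSq g K a = wedgeInvariant K (g.toSection a)) := by
  refine ⟨fun i j => ?_, fun X hX i => ?_, fun E' _ _ N _ _ ι hH hinv =>
    metricWedgeNormSq_eq_zero b hK hH hinv, ⟨radicalWeight hideal, fun X a => ?_,
    fun θ _ => ⟨contMDiff_wedgeInvariant K θ, fun X => ?_⟩⟩, fun a => ?_⟩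
  · rw [hK, hK]
    exact congr(($(lie_radicalAbelianIdeal_eq_zero (b i).2 (b j).2) : VField E M))
  · rw [lie_eq_sum_toMatrix_smul hideal hK ⟨X, hX⟩ i]
    exact Submodule.sum_smul_mem _ _ fun k _ => Submodule.subset_span ⟨k, rfl⟩
  · rw [radicalWeight_eq_trace hideal b]
    exact lieWedgeAt_eq_trace_smul (lie_eq_sum_toMatrix_smul hideal hK X) a
  · rw [mvfderiv_wedgeInvariant (lie_eq_sum_toMatrix_smul hideal hK X), LinearMap.smul_apply,
      radicalWeight_eq_trace hideal b, smul_eq_mul]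
  · rw [metricWedgeNormSq_eq_det, wedgeInvariant_eq_det]
    rfl

theorem theorem2
    {E : Type*} [NormedAddCommGroup E] [NormedSpace ℝ E] [FiniteDimensional ℝ E]
    {M : Type*} [TopologicalSpace M] [ChartedSpace E M] [IsManifold 𝓘(ℝ, E) ∞ M]
    [T2Space M] [SecondCountableTopology M] [ConnectedSpace M]
    (g : LorentzMetric E M)
    (𝔤 : LieSubalgebra ℝ (VField E M)) (h𝔨𝔤 : killingAlgebra g ≤ 𝔤)
    (hideal : ∀ X ∈ 𝔤, ∀ K ∈ killingAlgebra g, ⁅X, K⁆ ∈ killingAlgebra g)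
    {r : ℕ} (b : Module.Basis (Fin r) ℝ (radicalAbelianIdeal (killingAlgebra g)))
    (K : Fin r → VField E M) (hK : ∀ i, K i = ((b i : killingAlgebra g) : VField E M)) :
    -- the ideal spanned by the `K i` is abelian, and an ideal of `𝔤`
    (∀ i j, ⁅K i, K j⁆ = 0) ∧
    (∀ X ∈ 𝔤, ∀ i, ⁅X, K i⁆ ∈ Submodule.span ℝ (Set.range K)) ∧
    -- vanishing on invariant Killing horizons
    (∀ (E' : Type*) [NormedAddCommGroup E'] [NormedSpace ℝ E'] [FiniteDimensional ℝ E']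
      (N : Type*) [TopologicalSpace N] [ChartedSpace E' N] [IsManifold 𝓘(ℝ, E') ∞ N]
      (ι : N → M), IsKillingHorizon (E' := E') g ι → IsKillingInvariant (E' := E') g ι →
      ∀ p, metricWedgeNormSq g K (ι p) = 0) ∧
    -- restriction of a relative invariant
    (∃ wt : 𝔤 →ₗ[ℝ] ℝ,
      (∀ (X : 𝔤) (a : M), lieWedgeAt (X : VField E M) K a = wt X • wedgeAt K a) ∧
      IsRelativeInvariantOn 𝔤 (lorentzBundle E M) (wedgeInvariant K) ((2 : ℝ) • wt)) ∧
    (∀ a, metricWedgeNormSq g K a = wedgeInvariant K (g.toSection a)) :=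
  have ⟨hab, hid, hhor, ⟨wt, hwt, hinv⟩, hres⟩ := theorem2_general g 𝔤 hideal b K hK
  ⟨hab, hid, fun E' _ _ _ N _ _ _ => hhor E' N, ⟨wt, hwt, fun θ _ => hinv θ ⟨⟩⟩, hres⟩
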